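/- **Theorem (Rényi operator-space entanglement of the translation-symmetric maximally mixed state).** Fix integers $d\ge 2$ and $k\ge 2$. For $L\ge 1$ consider a ring of $L$ qudits of dimension $d$, with Hilbert space $(\mathbb C^d)^{\otimes L}$, and let $T$ be the translation by one site. Let $P=\frac1L\sum_{n=0}^{L-1}T^n$ be the projector onto the translation-invariant subspace and $\rho_{\mathcal T}=P/\operatorname{Tr}P$. Let $$|\rho_{\mathcal T}\rangle\rangle\ \propto\ \sum_{\sigma\in\{0,\dots,d-1\}^L}(\rho_{\mathcal T}\otimes \mathbb 1)\,|\sigma\rangle|\sigma\rangle$$ be its vectorization in the doubled space, normalized to a unit vector. For an interval $A$ of consecutive sites of the ring, let $R_A$ be the reduced density matrix of $|\rho_{\mathcal T}\rangle\rangle\langle\langle\rho_{\mathcal T}|$ on $A\cup\overline A$ (the sites of $A$ in both copies), and let $S_k(R_A)=\frac1{1-k}\log\operatorname{Tr}R_A^k$ be the Rényi-$k$ operator-space entanglement. Put $$s_k(L)=\frac{k}{k-1}\log L-\frac1{k-1}\log\left(\frac{1+d^{-2(k-1)}}{1-d^{-2(k-1)}}\right),$$ which does not depend on $A$. 1. There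 is a constant $C=C(d,k)$ such that for every $L\ge1$ and every interval $A$ with $|A|\le L/2$, $$\bigl|S_k(R_A)-s_k(L)\bigr|\ \le\ C\,L^{2k}\left(d^{-2|A|}+d^{-L/2}\right).$$ 2. Consequently, for $\log L\ll|A|\le L/2$, the correction is exponentially small in $|A|$: for every $c<1$ there are constants $K,C$, depending only on $d,k,c$, such that for every $L\ge1$ and every interval $A$ with $K\log L\le |A|\le L/2$, $$\bigl|S_k(R_A)-s_k(L)\bigr|\ \le\ C\,d^{-c|A|}.$$ -/

import Mathlib

/-- Computational-basis labels of a ring of `L` qudits of local dimension `d`.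
The sites are the elements of `ZMod L`, so that site arithmetic is periodic. -/
abbrev RingConfig (L d : ℕ) : Type := ZMod L → Fin d

/-- The translation operator `T` by one site: `T` sends the basis state `|σ⟩` to `|τ⟩` with
`τ (i + 1) = σ i`. -/
def translationOp (L d : ℕ) [NeZero L] : Matrix (RingConfig L d) (RingConfig L d) ℂ :=
  Matrix.of fun τ σ => if (∀ i : ZMod L, τ (i + 1) = σ i) then 1 else 0

/-- The projector `P = (1/L) (1 + T + ⋯ + T^(L-1))` onto the zero-momentum subspace. -/
noncomputable def translationProjector (L d : ℕ) [NeZero L] :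
    Matrix (RingConfig L d) (RingConfig L d) ℂ :=
  (L : ℂ)⁻¹ • ∑ n ∈ Finset.range L, translationOp L d ^ n

/-- The maximally mixed invariant state of strong translation symmetry, `P / Tr P`. -/
noncomputable def translationMMIS (L d : ℕ) [NeZero L] :
    Matrix (RingConfig L d) (RingConfig L d) ℂ :=
  (translationProjector L d).trace⁻¹ • translationProjector L d

/-- The vectorization `∑_σ (M ⊗ 1) |σ⟩|σ⟩` of an operator `M`, written in the computational basis
`|τ⟩|σ⟩` of the doubled space, and normalized to a unit vector. -/
noncomputable def doubledState {ι : Type*} [Fintype ι] (M : Matrix ι ι ℂ) : ι × ι → ℂ :=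
  fun x => M x.1 x.2 / (Real.sqrt (∑ y : ι × ι, ‖M y.1 y.2‖ ^ 2) : ℂ)

/-- The configuration that equals `α` on `A` and `γ` on the complement of `A`. -/
def glueConfig {L d : ℕ} (A : Finset (ZMod L)) (α : {i // i ∈ A} → Fin d)
    (γ : {i // i ∉ A} → Fin d) : RingConfig L d :=
  fun i => if h : i ∈ A then α ⟨i, h⟩ else γ ⟨i, h⟩

/-- Basis labels of the doubled subsystem `A ∪ Ā`: the region `A` of the ket copy together with the
same region of the bra copy. -/
abbrev DoubledRegionConfig {L : ℕ} (d : ℕ) (A : Finset (ZMod L)) : Type :=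
  ({i // i ∈ A} → Fin d) × ({i // i ∈ A} → Fin d)

/-- The partial trace, over the complement of `A` in both copies, of an operator on the doubled
space. -/
def partialTraceDoubled {L d : ℕ} [NeZero L] (A : Finset (ZMod L))
    (M : Matrix (RingConfig L d × RingConfig L d) (RingConfig L d × RingConfig L d) ℂ) :
    Matrix (DoubledRegionConfig d A) (DoubledRegionConfig d A) ℂ :=
  Matrix.of fun x y =>
    ∑ γ : {i // i ∉ A} → Fin d, ∑ δ : {i // i ∉ A} → Fin d,
      M (glueConfig A x.1 γ, glueConfig A x.2 δ) (glueConfig A y.1 γ, glueConfig A y.2 δ)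

/-- The reduced density matrix on `A ∪ Ā` of the normalized doubled state of an operator `ρ`. -/
noncomputable def doubledReducedDensity {L d : ℕ} [NeZero L] (A : Finset (ZMod L))
    (ρ : Matrix (RingConfig L d) (RingConfig L d) ℂ) :
    Matrix (DoubledRegionConfig d A) (DoubledRegionConfig d A) ℂ :=
  partialTraceDoubled A (Matrix.vecMulVec (doubledState ρ) (star (doubledState ρ)))

/-- The Rényi-`k` entropy `(1 / (1 - k)) log Tr R^k` of a density matrix (natural logarithm). -/
noncomputable def renyiEntropy {ι : Type*} [Fintype ι] [DecidableEq ι] (k : ℕ)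
    (R : Matrix ι ι ℂ) : ℝ :=
  (1 / (1 - (k : ℝ))) * Real.log (R ^ k).trace.re

/-- The Rényi-`k` operator-space entanglement of `ρ` for the region `A`. -/
noncomputable def renyiOSE {L d : ℕ} [NeZero L] (k : ℕ) (A : Finset (ZMod L))
    (ρ : Matrix (RingConfig L d) (RingConfig L d) ℂ) : ℝ :=
  renyiEntropy k (doubledReducedDensity A ρ)

/-- `A` is an interval `{s, s + 1, …, s + a - 1}` of consecutive sites of the ring. -/
def IsRingInterval {L : ℕ} (A : Finset (ZMod L)) : Prop :=
  ∃ (s : ZMod L) (a : ℕ), A = (Finset.range a).image fun j : ℕ => s + (j : ZMod L)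

/-! Up to a scalar, the vectorized state is the sum of the vectorizations of the `L` translations.
Across the cut between `A` and its complement, each of these is a 0/1 matrix `V_n = translationBlock
d A n`, so `R_A = W Wᵀ / Tr (W Wᵀ)` with `W = ∑ V_n`. The rescaled `v_n = d^(-L/2) V_n` has
Frobenius norm one and is a multiple of a partial isometry: `v_n v_nᵀ v_n = c_n v_n` with `c_n =
d^(-2 min(n, L-n, |A|))`, the exponent counting the sites carried across the cut
(`translationBlock_mul_transpose_mul`, `card_crossing`). Hence `Tr (v_n v_nᵀ)^k = c_n^(k-1)`, and
the sum over `n` is nearly a two-sided geometric series in `x = d^(-2(k-1))`, with limit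
`(1+x)/(1-x)` (`sum_crossingWeight_bounds`).

Distinct translations are almost orthogonal on both sides of the cut. The squared norms of `v_nᵀ
v_m` and `v_n v_mᵀ` are at most `d^(-2|A|)` and `d^(-L/2)`, by counting configurations
(`frobSq_translation_overlap_le`), and the overlap `Tr v_n v_mᵀ` is at most `d^(-L/2)`. Therefore
each of the at most `L^(2k)` mixed words in the expansion of `Tr (∑ v_n)(∑ v_n)ᵀ ⋯` is small
(`abs_trace_word_le`, `trace_sum_mul_transpose_pow_bounds`). The normalization `Tr (W Wᵀ)` is close
to `L d^L`, whose `k`-th power produces the `log L` term. -/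

/-- The squared Frobenius norm of a real matrix. -/
def frobSq {m n : Type*} [Fintype m] [Fintype n] (X : Matrix m n ℝ) : ℝ :=
  ∑ i, ∑ j, X i j ^ 2

/-! ### Traces of words in almost orthogonal contractions. -/

section Words

variable {n ι : Type*} [Fintype n]

theorem frobSq_nonneg {m n : Type*} [Fintype m] [Fintype n] (X : Matrix m n ℝ) : 0 ≤ frobSq X :=
  Finset.sum_nonneg fun _ _ => Finset.sum_nonneg fun _ _ => sq_nonneg _

theorem frobSq_eq_trace {m n : Type*} [Fintype m] [Fintype n] (X : Matrix m n ℝ) :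
    frobSq X = (X.transpose * X).trace := by
  simp only [frobSq, Matrix.trace, Matrix.diag, Matrix.mul_apply, Matrix.transpose_apply]
  rw [Finset.sum_comm]
  simp only [sq]

theorem trace_mul_sq_le {m n : Type*} [Fintype m] [Fintype n]
    (X : Matrix m n ℝ) (Y : Matrix n m ℝ) :
    (X * Y).trace ^ 2 ≤ frobSq X * frobSq Y := by
  have h := Finset.sum_mul_sq_le_sq_mul_sq (Finset.univ : Finset (m × n))
    (fun p => X p.1 p.2) (fun p => Y p.2 p.1)
  simp only [Fintype.sum_prod_type] at h
  rw [Finset.sum_comm (f := fun x y => Y y x ^ 2)] at h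
  simpa only [frobSq, Matrix.trace, Matrix.diag, Matrix.mul_apply] using h

/-- `K` does not increase the Frobenius norm when multiplied from the left. -/
def FrobContraction (K : Matrix n n ℝ) : Prop :=
  ∀ X : Matrix n n ℝ, frobSq (K * X) ≤ frobSq X

/-- Cauchy–Schwarz for `K₂ X` and `K₁ Y` after a cyclic rotation: two disjoint small blocks make a
word small, whatever contractions separate them. -/
theorem abs_trace_two_blocks_le {δ : ℝ} {X Y K₁ K₂ : Matrix n n ℝ}
    (h₁ : FrobContraction K₁) (h₂ : FrobContraction K₂) (hX : frobSq X ≤ δ) (hY : frobSq Y ≤ δ) :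
    |(X * K₁ * Y * K₂).trace| ≤ δ := by
  have hδ : 0 ≤ δ := (frobSq_nonneg X).trans hX
  apply abs_le_of_sq_le_sq _ hδ
  have e : (X * K₁ * Y * K₂).trace = ((K₂ * X) * (K₁ * Y)).trace := by
    rw [Matrix.trace_mul_comm]
    simp only [Matrix.mul_assoc]
  rw [e, sq δ]
  exact (trace_mul_sq_le _ _).trans
    (mul_le_mul ((h₂ X).trans hX) ((h₁ Y).trans hY) (frobSq_nonneg _) hδ)

variable [DecidableEq n]

theorem FrobContraction.list_prod {H : ι → Matrix n n ℝ} (hH : ∀ i, FrobContraction (H i))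
    (l : List ι) : FrobContraction (l.map H).prod := by
  induction l with
  | nil => intro X; simp
  | cons a l ih =>
    intro X
    rw [List.map_cons, List.prod_cons, Matrix.mul_assoc]
    exact (hH a _).trans (ih X)

theorem List.exists_adjacent_ne_or_eq_replicate [Inhabited ι] (l : List ι) :
    (∃ p, l = List.replicate l.length p) ∨
      ∃ l₁ z a l₂, l = l₁ ++ z :: a :: l₂ ∧ z ≠ a := by
  induction l with
  | nil => exact Or.inl ⟨default, rfl⟩
  | cons x l ih =>
    rcases ih with ⟨p, hp⟩ | ⟨l₁, z, a, l₂, rfl, h⟩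
    · rcases l with _ | ⟨y, l⟩
      · exact Or.inl ⟨x, rfl⟩
      · by_cases hxy : x = y
        · subst hxy
          left
          refine ⟨x, ?_⟩
          have hpx : x = p := by
            simp only [List.length_cons, List.replicate_succ, List.cons.injEq] at hp
            exact hp.1
          subst hpx
          rw [List.length_cons, List.replicate_succ, ← hp]
        · exact Or.inr ⟨[], x, y, l, rfl, hxy⟩
    · exact Or.inr ⟨x :: l₁, z, a, l₂, rfl, h⟩

/-- A word of length at least four in contractions that is not constant has a small trace. -/
theorem abs_trace_word_le {H : ι → Matrix n n ℝ} {δ : ℝ} {q : ℕ} (hq : 4 ≤ q)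
    (hH : ∀ i, FrobContraction (H i)) (h₂ : ∀ i j, i ≠ j → frobSq (H i * H j) ≤ δ)
    (h₁ : ∀ i j, i ≠ j → |(H i * H j ^ (q - 1)).trace| ≤ δ)
    (l : List ι) (hl : l.length = q) (hc : ∀ p, l ≠ List.replicate q p) :
    |((l.map H).prod).trace| ≤ δ := by
  have : Inhabited ι := ⟨l.head (by rintro rfl; simp at hl; omega)⟩
  rcases l.exists_adjacent_ne_or_eq_replicate with ⟨p, hp⟩ | ⟨l₁, z, a, l₂, rfl, hza⟩
  · exact absurd (hl ▸ hp) (hc p)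
  -- The trace is cyclic, so the unequal pair `z a` may be rotated to the front.
  have e : (((l₁ ++ z :: a :: l₂).map H).prod).trace
      = (H z * H a * ((l₂ ++ l₁).map H).prod).trace := by
    simp only [List.map_append, List.map_cons, List.prod_append, List.prod_cons]
    rw [Matrix.trace_mul_comm]
    simp only [Matrix.mul_assoc]
  rw [e]
  have hlen : (l₂ ++ l₁).length = q - 2 := by
    simp only [List.length_append, List.length_cons] at hl ⊢
    omega
  generalize l₂ ++ l₁ = m at hlen
  rcases m.exists_adjacent_ne_or_eq_replicate with ⟨p, hp⟩ | ⟨m₁, b, c, m₂, rfl, hbc⟩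
  · obtain ⟨r, rfl⟩ : ∃ r, q = r + 4 := ⟨q - 4, by omega⟩
    rw [hlen] at hp
    rw [hp, List.map_replicate, List.prod_replicate]
    -- The rest is constant. If its letter is `a` or `z`, a single letter differs from all the
    -- others, which is the case covered by `h₁`.
    by_cases hpa : p = a
    · subst hpa
      have := h₁ z p hza
      rwa [show r + 4 - 1 = (r + 4 - 2) + 1 by omega, pow_succ', ← Matrix.mul_assoc] at this
    by_cases hpz : p = z
    · subst hpz
      have := h₁ a p hza.symm
      rwa [show r + 4 - 1 = (r + 4 - 2) + 1 by omega, pow_succ, ← Matrix.mul_assoc,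
        Matrix.trace_mul_comm, ← Matrix.mul_assoc] at this
    -- The pairs `a p` and, cyclically, `p z` are disjoint because at least two letters `p` are
    -- present; this is where `4 ≤ q` matters.
    · have := abs_trace_two_blocks_le
        (FrobContraction.list_prod hH (List.replicate r p)) (FrobContraction.list_prod hH [])
        (h₂ a p (Ne.symm hpa)) (h₂ p z hpz)
      rw [List.map_replicate, List.prod_replicate] at this
      simp only [List.map_nil, List.prod_nil, Matrix.mul_one] at this
      rw [Matrix.mul_assoc, Matrix.trace_mul_comm, show r + 4 - 2 = (1 + r) + 1 by omega, pow_add,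
        pow_add, pow_one]
      simpa only [Matrix.mul_assoc] using this
  · have := abs_trace_two_blocks_le (FrobContraction.list_prod hH m₁)
      (FrobContraction.list_prod hH m₂) (h₂ z a hza) (h₂ b c hbc)
    simpa only [List.map_append, List.map_cons, List.prod_append, List.prod_cons,
      Matrix.mul_assoc] using this

theorem sum_pow_eq_sum_ofFn {R : Type*} [Semiring R] [Fintype ι] (H : ι → R) (q : ℕ) :
    (∑ i, H i) ^ q = ∑ f : Fin q → ι, ((List.ofFn f).map H).prod := by
  induction q with
  | zero => simp
  | succ q ih =>
    rw [pow_succ', ih, Finset.sum_mul_sum, ← Finset.sum_product', Finset.univ_product_univ,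
      ← (Fin.consEquiv fun _ : Fin (q + 1) => ι).sum_comp]
    refine Finset.sum_congr rfl fun x _ => ?_
    simp [Fin.consEquiv, List.ofFn_succ]

/-- The constant words give the main term. Nonnegative entries make every other word contribute at
least zero, which is the lower bound; the upper bound counts the other words crudely. -/
theorem trace_sum_pow_sub_bounds [Fintype ι] [DecidableEq ι] {H : ι → Matrix n n ℝ} {δ : ℝ} {q : ℕ}
    (hq : 4 ≤ q) (hδ : 0 ≤ δ) (hpos : ∀ i x y, 0 ≤ H i x y)
    (hH : ∀ i, FrobContraction (H i)) (h₂ : ∀ i j, i ≠ j → frobSq (H i * H j) ≤ δ)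
    (h₁ : ∀ i j, i ≠ j → |(H i * H j ^ (q - 1)).trace| ≤ δ) :
    ∑ i, (H i ^ q).trace ≤ ((∑ i, H i) ^ q).trace ∧
      ((∑ i, H i) ^ q).trace ≤ ∑ i, (H i ^ q).trace + (Fintype.card ι : ℝ) ^ q * δ := by
  have hinj : Function.Injective fun (i : ι) (_ : Fin q) => i :=
    fun i j h => congrFun h ⟨0, by omega⟩
  have hconst : ∑ i, (H i ^ q).trace
      = ∑ f ∈ Finset.univ.image (fun (i : ι) (_ : Fin q) => i),
          (((List.ofFn f).map H).prod).trace := by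
    rw [Finset.sum_image fun i _ j _ h => hinj h]
    refine Finset.sum_congr rfl fun i _ => ?_
    rw [List.ofFn_const, List.map_replicate, List.prod_replicate]
  have hwpos : ∀ l : List ι, ∀ x y, 0 ≤ (l.map H).prod x y := by
    intro l
    induction l with
    | nil =>
      intro x y
      simp only [List.map_nil, List.prod_nil, Matrix.one_apply]
      split_ifs <;> norm_num
    | cons a l ih =>
      intro x y
      rw [List.map_cons, List.prod_cons, Matrix.mul_apply]
      exact Finset.sum_nonneg fun z _ => mul_nonneg (hpos a x z) (ih z y)
  rw [sum_pow_eq_sum_ofFn, Matrix.trace_sum, hconst,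
    ← Finset.sum_add_sum_compl (Finset.univ.image fun (i : ι) (_ : Fin q) => i)]
  refine ⟨le_add_of_nonneg_right (Finset.sum_nonneg fun f _ =>
    Finset.sum_nonneg fun x _ => hwpos _ x x), add_le_add_right ?_ _⟩
  refine (Finset.sum_le_card_nsmul _ _ δ fun f hf => ?_).trans ?_
  · refine (le_abs_self _).trans (abs_trace_word_le hq hH h₂ h₁ _ (by simp) fun p hp => ?_)
    rw [Finset.mem_compl, Finset.mem_image] at hf
    refine hf ⟨p, Finset.mem_univ _, ?_⟩
    rw [← List.ofFn_const] at hp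
    exact (List.ofFn_injective hp).symm
  · rw [nsmul_eq_mul]
    refine mul_le_mul_of_nonneg_right ?_ hδ
    calc ((Finset.image (fun (i : ι) (_ : Fin q) => i) Finset.univ)ᶜ.card : ℝ)
        ≤ Fintype.card (Fin q → ι) := by exact_mod_cast Finset.card_le_univ _
      _ = (Fintype.card ι : ℝ) ^ q := by simp

end Words

/-! ### Symmetric dilation of rectangular matrices, turning alternating products of `v` and `vᵀ`
into plain powers. -/

/-- The symmetric matrix with off-diagonal blocks `v` and `vᵀ`. -/
def symBlock {m n : Type*} (v : Matrix m n ℝ) : Matrix (m ⊕ n) (m ⊕ n) ℝ :=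
  Matrix.fromBlocks 0 v v.transpose 0

theorem symBlock_sum {m n ι : Type*} (s : Finset ι) (v : ι → Matrix m n ℝ) :
    symBlock (∑ i ∈ s, v i) = ∑ i ∈ s, symBlock (v i) := by
  ext x y
  rw [Matrix.sum_apply]
  rcases x with x | x <;> rcases y with y | y <;>
    simp [symBlock, Matrix.sum_apply]

theorem trace_fromBlocks_eq {m n : Type*} [Fintype m] [Fintype n] (A : Matrix m m ℝ) (B : Matrix m n ℝ) (C : Matrix n m ℝ)
    (D : Matrix n n ℝ) : (Matrix.fromBlocks A B C D).trace = A.trace + D.trace := by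
  simp [Matrix.trace, Fintype.sum_sum_type]

section Blocks

variable {m n : Type*} [Fintype m] [Fintype n] [DecidableEq m] [DecidableEq n]

theorem symBlock_mul (v w : Matrix m n ℝ) :
    symBlock v * symBlock w
      = Matrix.fromBlocks (v * w.transpose) 0 0 (v.transpose * w) := by
  simp [symBlock, Matrix.fromBlocks_multiply]

theorem frobSq_symBlock_mul (v w : Matrix m n ℝ) :
    frobSq (symBlock v * symBlock w)
      = frobSq (v * w.transpose) + frobSq (v.transpose * w) := by
  rw [symBlock_mul]
  simp [frobSq, Fintype.sum_sum_type]

theorem trace_symBlock_mul (v w : Matrix m n ℝ) :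
    (symBlock v * symBlock w).trace = 2 * (v * w.transpose).trace := by
  rw [symBlock_mul, trace_fromBlocks_eq, ← Matrix.trace_transpose (v.transpose * w),
    Matrix.transpose_mul, Matrix.transpose_transpose, Matrix.trace_mul_comm w.transpose,
    two_mul]

/-- The square is block diagonal with blocks `v vᵀ` and `vᵀ v`, whose positive powers have equal
traces. At `k = 0` the two sizes would differ. -/
theorem trace_symBlock_pow (v : Matrix m n ℝ) (k : ℕ) (hk : 1 ≤ k) :
    (symBlock v ^ (2 * k)).trace = 2 * ((v * v.transpose) ^ k).trace := by
  have hd : ∀ (A : Matrix m m ℝ) (B : Matrix n n ℝ) (k : ℕ),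
      Matrix.fromBlocks A 0 0 B ^ k = Matrix.fromBlocks (A ^ k) 0 0 (B ^ k) := by
    intro A B k
    induction k with
    | zero => simp
    | succ k ih => simp [pow_succ, ih, Matrix.fromBlocks_multiply]
  obtain ⟨k, rfl⟩ : ∃ r, k = r + 1 := ⟨k - 1, by omega⟩
  have hs : ∀ k : ℕ, v * (v.transpose * v) ^ k = (v * v.transpose) ^ k * v := by
    intro k
    induction k with
    | zero => simp
    | succ k ih =>
      rw [pow_succ, ← Matrix.mul_assoc, ih, pow_succ]
      simp only [Matrix.mul_assoc]
  rw [pow_mul, sq, symBlock_mul, hd, trace_fromBlocks_eq]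
  have : ((v.transpose * v) ^ (k + 1)).trace = ((v * v.transpose) ^ (k + 1)).trace := by
    rw [pow_succ', Matrix.mul_assoc, Matrix.trace_mul_comm, hs, Matrix.mul_assoc, ← pow_succ]
  rw [this]
  ring

theorem symBlock_pow_three {v : Matrix m n ℝ} {c : ℝ} (h : v * v.transpose * v = c • v) :
    symBlock v ^ 3 = c • symBlock v := by
  have h' : v.transpose * v * v.transpose = c • v.transpose := by
    rw [← Matrix.transpose_smul, ← h]
    simp [Matrix.transpose_mul, Matrix.mul_assoc]
  rw [pow_succ, sq, symBlock_mul]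
  simp [symBlock, Matrix.fromBlocks_multiply, Matrix.fromBlocks_smul, h, h']

/-- Collapses `H_j^(2k-1)` to a multiple of `H_j`, so that the word with one exceptional letter
reduces to a two-letter overlap. -/
theorem pow_odd_of_pow_three {R : Type*} [Ring R] [Module ℝ R] [IsScalarTower ℝ R R]
    {H : R} {c : ℝ} (h : H ^ 3 = c • H) (j : ℕ) :
    H ^ (2 * j + 1) = c ^ j • H := by
  induction j with
  | zero => simp
  | succ j ih =>
    rw [show 2 * (j + 1) + 1 = (2 * j + 1) + 2 by ring, pow_add, ih, smul_mul_assoc,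
      ← pow_succ', h, smul_smul, pow_succ]

/-- A symmetric `H` with `H³ = c H` and `0 < c ≤ 1` is a contraction. -/
theorem frobContraction_of_pow_three {H : Matrix n n ℝ} {c : ℝ} (hs : H.transpose = H)
    (hc : 0 < c) (hc1 : c ≤ 1) (h : H ^ 3 = c • H) : FrobContraction H := by
  intro X
  have h4 : H * H * (H * H) = c • (H * H) := by
    rw [← smul_mul_assoc, ← h]
    noncomm_ring
  have hE : c * frobSq (H * X) = frobSq (H * H * X) := by
    rw [frobSq_eq_trace, frobSq_eq_trace]
    have : (H * H * X).transpose * (H * H * X) = X.transpose * (H * H * (H * H)) * X := by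
      simp only [Matrix.transpose_mul, hs, Matrix.mul_assoc]
    rw [this, h4]
    simp [Matrix.transpose_mul, hs, Matrix.mul_assoc]
  -- `H² / c` is an orthogonal projection; this is Pythagoras for the component of `X` that it
  -- removes.
  have hD : 0 ≤ c ^ 2 * frobSq X - c * frobSq (H * X) := by
    have e : frobSq (c • X - H * H * X) = c ^ 2 * frobSq X - c * frobSq (H * X) := by
      have e1 : (c • X - H * H * X).transpose * (c • X - H * H * X)
          = c ^ 2 • (X.transpose * X) - (2 * c) • (X.transpose * (H * H) * X)
            + (H * H * X).transpose * (H * H * X) := by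
        simp only [Matrix.transpose_sub, Matrix.transpose_smul, Matrix.transpose_mul, hs,
          Matrix.sub_mul, Matrix.mul_sub, Matrix.smul_mul, Matrix.mul_smul, Matrix.mul_assoc]
        module
      have e2 : (X.transpose * (H * H) * X).trace = frobSq (H * X) := by
        rw [frobSq_eq_trace]
        simp only [Matrix.transpose_mul, hs, Matrix.mul_assoc]
      rw [frobSq_eq_trace, e1, Matrix.trace_add, Matrix.trace_sub, Matrix.trace_smul,
        Matrix.trace_smul, e2, ← frobSq_eq_trace, ← frobSq_eq_trace, ← hE, smul_eq_mul,
        smul_eq_mul]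
      ring
    rw [← e]
    exact frobSq_nonneg _
  have h5 : frobSq (H * X) ≤ c * frobSq X := by
    have : 0 ≤ c * (c * frobSq X - frobSq (H * X)) := by linarith
    have := nonneg_of_mul_nonneg_right this hc
    linarith
  exact h5.trans (mul_le_of_le_one_left (frobSq_nonneg X) hc1)

theorem trace_sum_mul_transpose_pow_bounds {ι : Type*} [Fintype ι] [DecidableEq ι]
    {v : ι → Matrix m n ℝ} {c : ι → ℝ} {ε : ℝ} {k : ℕ} (hk : 2 ≤ k) (hε : 0 ≤ ε)
    (hpos : ∀ i x y, 0 ≤ v i x y) (hc0 : ∀ i, 0 < c i) (hc1 : ∀ i, c i ≤ 1)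
    (hv : ∀ i, v i * (v i).transpose * v i = c i • v i)
    (htr : ∀ i, (v i * (v i).transpose).trace = 1)
    (hfrob : ∀ i j, i ≠ j →
      frobSq (v i * (v j).transpose) + frobSq ((v i).transpose * v j) ≤ 2 * ε)
    (hoff : ∀ i j, i ≠ j → |(v i * (v j).transpose).trace| ≤ ε) :
    ∑ i, c i ^ (k - 1) ≤ (((∑ i, v i) * (∑ i, v i).transpose) ^ k).trace ∧
      (((∑ i, v i) * (∑ i, v i).transpose) ^ k).trace
        ≤ ∑ i, c i ^ (k - 1) + (Fintype.card ι : ℝ) ^ (2 * k) * ε := by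
  have hodd : ∀ i, symBlock (v i) ^ (2 * k - 1) = c i ^ (k - 1) • symBlock (v i) := by
    intro i
    rw [← pow_odd_of_pow_three (symBlock_pow_three (hv i))]
    congr 1
    omega
  have hdiag : ∀ i, (symBlock (v i) ^ (2 * k)).trace = 2 * c i ^ (k - 1) := by
    intro i
    rw [show 2 * k = (2 * k - 1) + 1 by omega, pow_succ, hodd, Matrix.smul_mul,
      Matrix.trace_smul, trace_symBlock_mul, htr, smul_eq_mul]
    ring
  -- The doubled error matches the factor two that the dilation puts on all traces.
  have hmain := trace_sum_pow_sub_bounds (H := fun i => symBlock (v i)) (q := 2 * k)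
    (δ := 2 * ε) (by omega) (by positivity) ?_ ?_ ?_ ?_
  · simp only [hdiag, ← Finset.mul_sum] at hmain
    rw [← symBlock_sum, trace_symBlock_pow _ _ (by omega)] at hmain
    constructor
    · linarith [hmain.1]
    · linarith [hmain.2]
  · intro i x y
    rcases x with x | x <;> rcases y with y | y <;> simp [symBlock, hpos]
  · intro i
    refine frobContraction_of_pow_three ?_ (hc0 i) (hc1 i) (symBlock_pow_three (hv i))
    simp [symBlock, Matrix.fromBlocks_transpose]
  · intro i j hij
    rw [frobSq_symBlock_mul]
    exact hfrob i j hij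
  · intro i j hij
    rw [hodd, Matrix.mul_smul, Matrix.trace_smul, trace_symBlock_mul, smul_eq_mul, abs_mul,
      abs_mul, abs_of_pos (pow_pos (hc0 j) _), abs_two]
    have h3 : c j ^ (k - 1) ≤ 1 := pow_le_one₀ (hc0 j).le (hc1 j)
    have := hoff i j hij
    calc c j ^ (k - 1) * (2 * |(v i * (v j).transpose).trace|) ≤ 1 * (2 * ε) := by gcongr
      _ = 2 * ε := one_mul _

end Blocks

/-! ### Translation orbits on the ring and intervals. -/

section Orbits

variable {L : ℕ} [NeZero L]

/-- A set of at most half the points of `X` that meets every orbit of `j ↦ j + t` inside `X`. -/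
theorem exists_half_transversal (X : Finset (ZMod L)) {t : ZMod L} (ht : t ≠ 0) :
    ∃ C : Finset (ZMod L), 2 * C.card ≤ X.card ∧
      ∀ j, (∀ r : ℕ, j + r • t ∈ X) → ∃ r : ℕ, j + r • t ∈ C := by
  classical
  -- One point, of minimal `val`, from each orbit contained in `X`. Such an orbit has at least two
  -- points, so `C` and `C + t` are disjoint subsets of `X`.
  let C := X.filter fun j => (∀ r : ℕ, j + r • t ∈ X) ∧ ∀ r : ℕ, j.val ≤ (j + r • t).val
  have hback : ∀ j : ZMod L, ∃ r : ℕ, j + t + r • t = j := by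
    intro j
    refine ⟨L - 1, ?_⟩
    have : t + (L - 1) • t = 0 := by
      rw [← succ_nsmul', Nat.sub_add_cancel (NeZero.one_le), nsmul_eq_mul]
      simp
    rw [add_assoc, this, add_zero]
  refine ⟨C, ?_, ?_⟩
  · have hinj : Function.Injective fun j : ZMod L => j + t := add_left_injective t
    have hdisj : Disjoint C (C.image fun j => j + t) := by
      rw [Finset.disjoint_left]
      intro j hj hj'
      obtain ⟨i, hi, rfl⟩ := Finset.mem_image.1 hj'
      have h1 := (Finset.mem_filter.1 hi).2.2 1
      obtain ⟨r, hr⟩ := hback i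
      have h2 := (Finset.mem_filter.1 hj).2.2 r
      rw [hr] at h2
      rw [one_nsmul] at h1
      have := ZMod.val_injective L (le_antisymm h1 h2)
      exact ht (by simpa using this)
    have hsub : C ∪ C.image (fun j => j + t) ⊆ X := by
      intro j hj
      rcases Finset.mem_union.1 hj with hj | hj
      · exact (Finset.mem_filter.1 hj).1
      · obtain ⟨i, hi, rfl⟩ := Finset.mem_image.1 hj
        simpa using (Finset.mem_filter.1 hi).2.1 1
    have := Finset.card_le_card hsub
    rw [Finset.card_union_of_disjoint hdisj, Finset.card_image_of_injective _ hinj] at this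
    omega
  · intro j hj
    obtain ⟨r, hr⟩ : ∃ r : ℕ, ∀ r' : ℕ, (j + r • t).val ≤ (j + r' • t).val := by
      obtain ⟨_, ⟨r, rfl⟩, h⟩ := WellFounded.has_min (wellFounded_lt (α := ℕ))
        (Set.range fun r : ℕ => (j + r • t).val) ⟨_, 0, rfl⟩
      exact ⟨r, fun r' => not_lt.1 (h _ ⟨r', rfl⟩)⟩
    refine ⟨r, Finset.mem_filter.2 ⟨hj r, fun r' => ?_, fun r' => ?_⟩⟩
    · rw [add_assoc, ← add_nsmul]
      exact hj _
    · rw [add_assoc, ← add_nsmul]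
      exact hr _

theorem IsRingInterval.exists_mem_iff {A : Finset (ZMod L)} (hA : IsRingInterval A)
    (hL : 2 * A.card ≤ L) : ∃ s : ZMod L, ∀ j, j ∈ A ↔ (j - s).val < A.card := by
  obtain ⟨s, a, rfl⟩ := hA
  have hL0 : 0 < L := NeZero.pos L
  have hmem : ∀ j, j ∈ (Finset.range a).image (fun j : ℕ => s + (j : ZMod L)) ↔ (j - s).val < a := by
    intro j
    simp only [Finset.mem_image, Finset.mem_range]
    constructor
    · rintro ⟨i, hi, rfl⟩
      rw [add_sub_cancel_left, ZMod.val_natCast]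
      exact (Nat.mod_le _ _).trans_lt hi
    · intro h
      exact ⟨_, h, by simp⟩
  -- A range longer than `L` would cover the ring, against `2 * A.card ≤ L`.
  have ha : a ≤ L := by
    by_contra h
    have : (Finset.range a).image (fun j : ℕ => s + (j : ZMod L)) = Finset.univ := by
      ext j
      rw [hmem]
      simpa using (ZMod.val_lt _).trans (not_le.1 h)
    rw [this, Finset.card_univ, ZMod.card] at hL
    omega
  have hcard : ((Finset.range a).image (fun j : ℕ => s + (j : ZMod L))).card = a := by
    rw [Finset.card_image_of_injOn, Finset.card_range]
    intro i hi j hj h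
    have h' : (i : ZMod L) = j := by simpa using h
    rw [ZMod.natCast_eq_natCast_iff'] at h'
    simp only [Finset.coe_range, Set.mem_Iio] at hi hj
    rwa [Nat.mod_eq_of_lt (by omega), Nat.mod_eq_of_lt (by omega)] at h'
  exact ⟨s, fun j => by rw [hcard]; exact hmem j⟩

theorem ZMod.val_add_eq_or (x y : ZMod L) :
    (x + y).val = x.val + y.val ∧ x.val + y.val < L ∨
      (x + y).val + L = x.val + y.val ∧ L ≤ x.val + y.val := by
  rcases lt_or_ge (x.val + y.val) L with h | h
  · exact Or.inl ⟨ZMod.val_add_of_lt h, h⟩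
  · exact Or.inr ⟨(ZMod.val_add_val_of_le h).symm, h⟩

/-- A step of length at most `L/2`, forward or backward, cannot jump over the complement of `A`,
which has at least `L/2` sites. An orbit staying in `A` would move monotonically inside it forever.
-/
theorem exists_orbit_notMem {A : Finset (ZMod L)} {s t : ZMod L} (ht : t ≠ 0)
    (hL : 2 * A.card ≤ L) (hA : ∀ j, j ∈ A ↔ (j - s).val < A.card) (j : ZMod L) :
    ∃ r : ℕ, j + r • t ∉ A := by
  by_contra! h
  have ht0 : 0 < t.val := Nat.pos_of_ne_zero fun h => ht ((ZMod.val_eq_zero t).1 h)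
  have hlt : ∀ r : ℕ, (j + r • t - s).val < A.card := fun r => (hA _).1 (h r)
  have hstep : ∀ r : ℕ, j + (r + 1) • t - s = (j + r • t - s) + t := by
    intro r
    rw [succ_nsmul]
    abel
  rcases le_or_gt (2 * t.val) L with h2 | h2
  · have key : ∀ r : ℕ, r ≤ (j + r • t - s).val := by
      intro r
      induction r with
      | zero => exact Nat.zero_le _
      | succ r ih =>
        have h3 := ZMod.val_add_eq_or (j + r • t - s) t
        rw [← hstep] at h3
        have := hlt r
        omega
    exact absurd (key A.card) (not_le.2 (hlt _))
  · have key : ∀ r : ℕ, r + (j + r • t - s).val ≤ (j + 0 • t - s).val := by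
      intro r
      induction r with
      | zero => simp
      | succ r ih =>
        have h3 := ZMod.val_add_eq_or (j + r • t - s) t
        rw [← hstep] at h3
        have := hlt (r + 1)
        have := ZMod.val_lt t
        omega
    have := key A.card
    have := hlt 0
    omega

/-- The number of sites of an interval that a translation moves out of or into the interval. -/
theorem card_crossing {A : Finset (ZMod L)} {s : ZMod L}
    (hL : 2 * A.card ≤ L) (hA : ∀ j, j ∈ A ↔ (j - s).val < A.card) (n : ZMod L) :
    (Finset.univ.filter fun i => ¬(i ∈ A ↔ i + n ∈ A)).card
      = 2 * min n.val (min (L - n.val) A.card) := by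
  classical
  have hL0 : 0 < L := NeZero.pos L
  have hn := ZMod.val_lt n
  have hout : (Finset.univ.filter fun i => i ∈ A ∧ i + n ∉ A).card
      = min n.val (min (L - n.val) A.card) := by
    have hr : (Finset.univ.filter fun i => i ∈ A ∧ i + n ∉ A).card
        = ((Finset.range A.card).filter fun p =>
            ¬(p + n.val < A.card ∨ L ≤ p + n.val)).card := by
      refine Finset.card_bij (fun i _ => (i - s).val) ?_ ?_ ?_
      · intro i hi
        simp only [Finset.mem_filter, Finset.mem_univ, true_and, hA] at hi
        rw [Finset.mem_filter, Finset.mem_range]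
        have h3 := ZMod.val_add_eq_or (i - s) n
        rw [show i - s + n = i + n - s by abel] at h3
        omega
      · intro i _ j _ h
        simpa using ZMod.val_injective L h
      · intro p hp
        rw [Finset.mem_filter, Finset.mem_range] at hp
        have hv : ((p : ZMod L)).val = p := ZMod.val_natCast_of_lt (by omega)
        refine ⟨s + p, ?_, by simp [hv]⟩
        simp only [Finset.mem_filter, Finset.mem_univ, true_and, hA]
        have h3 := ZMod.val_add_eq_or (p : ZMod L) n
        rw [hv] at h3
        rw [add_sub_cancel_left, hv, show s + p + n - s = p + n by abel]
        omega
    rw [hr]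
    have : ((Finset.range A.card).filter fun p => ¬(p + n.val < A.card ∨ L ≤ p + n.val))
        = Finset.Ico (A.card - n.val) (min A.card (L - n.val)) := by
      ext p
      simp only [Finset.mem_filter, Finset.mem_range, Finset.mem_Ico]
      omega
    rw [this, Nat.card_Ico]
    omega
  -- Translation is a bijection, so as many sites enter `A` as leave it.
  have hin : (Finset.univ.filter fun i => i ∉ A ∧ i + n ∈ A).card
      = (Finset.univ.filter fun i => i ∈ A ∧ i + n ∉ A).card := by
    have h1 : (Finset.univ.filter fun i => i ∉ A ∧ i + n ∈ A).card
        + (Finset.univ.filter fun i => i ∈ A ∧ i + n ∈ A).card = A.card := by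
      rw [← Finset.card_union_of_disjoint, ← Finset.filter_or]
      · refine Finset.card_bij (fun i _ => i + n) ?_ ?_ ?_
        · intro i hi
          simp only [Finset.mem_filter, Finset.mem_univ, true_and] at hi
          tauto
        · intro i _ j _ h
          simpa using h
        · intro j hj
          refine ⟨j - n, ?_, by simp⟩
          simp only [Finset.mem_filter, Finset.mem_univ, true_and, sub_add_cancel]
          tauto
      · exact Finset.disjoint_filter.2 fun i _ h h' => h.1 h'.1
    have h2 : (Finset.univ.filter fun i => i ∈ A ∧ i + n ∉ A).card
        + (Finset.univ.filter fun i => i ∈ A ∧ i + n ∈ A).card = A.card := by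
      rw [← Finset.card_union_of_disjoint, ← Finset.filter_or]
      · congr 1
        ext i
        simp only [Finset.mem_filter, Finset.mem_univ, true_and]
        tauto
      · exact Finset.disjoint_filter.2 fun i _ h h' => h.2 h'.2
    omega
  have : (Finset.univ.filter fun i => ¬(i ∈ A ↔ i + n ∈ A))
      = (Finset.univ.filter fun i => i ∈ A ∧ i + n ∉ A)
        ∪ (Finset.univ.filter fun i => i ∉ A ∧ i + n ∈ A) := by
    ext i
    simp only [Finset.mem_filter, Finset.mem_univ, true_and, Finset.mem_union]
    tauto
  rw [this, Finset.card_union_of_disjoint, hin, hout, two_mul]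
  exact Finset.disjoint_filter.2 fun i _ h h' => h'.1 h.1

end Orbits

/-! ### Counting bounds for overlaps of two translations. -/

section Counting

variable {L d : ℕ}

/-- A discrepancy between `σ` and `σ'` at `j` forces one at `j + (m - n)`, and that site lies in
`X`. It thus spreads along an orbit contained in `X`, which must meet `C`, where there is none. -/
theorem eq_of_agree_outside {X C : Finset (ZMod L)} {n m : ZMod L}
    (hC : ∀ j, (∀ r : ℕ, j + r • (m - n) ∈ X) → ∃ r : ℕ, j + r • (m - n) ∈ C)
    {σ τ σ' τ' : RingConfig L d}
    (h₁ : ∀ i ∈ X, σ i = τ i) (h₂ : ∀ i ∈ X, σ (i + n) = τ (i + m))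
    (h₁' : ∀ i ∈ X, σ' i = τ' i) (h₂' : ∀ i ∈ X, σ' (i + n) = τ' (i + m))
    (g₁ : ∀ i ∉ X, τ i = τ' i) (g₂ : ∀ i ∉ X, σ (i + n) = σ' (i + n))
    (g₃ : ∀ i ∈ C, σ i = σ' i) : σ = σ' ∧ τ = τ' := by
  have hstep : ∀ j, σ j ≠ σ' j → j + (m - n) ∈ X ∧ σ (j + (m - n)) ≠ σ' (j + (m - n)) := by
    intro j hj
    have hjX : j - n ∈ X := by
      by_contra h
      exact hj (by simpa using g₂ _ h)
    have e := h₂ _ hjX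
    have e' := h₂' _ hjX
    rw [sub_add_cancel, show j - n + m = j + (m - n) by abel] at e e'
    rw [e, e'] at hj
    have hX : j + (m - n) ∈ X := by
      by_contra h
      exact hj (g₁ _ h)
    exact ⟨hX, by rwa [h₁ _ hX, h₁' _ hX]⟩
  have hσ : σ = σ' := by
    by_contra h
    obtain ⟨j, hj⟩ := Function.ne_iff.1 h
    have hall : ∀ r : ℕ, j + (m - n) + r • (m - n) ∈ X ∧
        σ (j + (m - n) + r • (m - n)) ≠ σ' (j + (m - n) + r • (m - n)) := by
      intro r
      induction r with
      | zero => simpa using hstep j hj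
      | succ r ih =>
        rw [succ_nsmul, ← add_assoc]
        exact hstep _ ih.2
    obtain ⟨r, hr⟩ := hC _ fun r => (hall r).1
    exact (hall r).2 (g₃ _ hr)
  refine ⟨hσ, funext fun i => ?_⟩
  by_cases hi : i ∈ X
  · rw [← h₁ i hi, ← h₁' i hi, hσ]
  · exact g₁ i hi

/-- The entries of the product are counts, and a sum of squared counts is at most the largest count
times the total. -/
theorem frobSq_indicator_mul_le {X Y Z : Type*} [Fintype X] [Fintype Y] [Fintype Z]
    (r : X → Y → Prop) (s : X → Z → Prop) [∀ x y, Decidable (r x y)] [∀ x z, Decidable (s x z)]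
    {κ N : ℕ} (hκ : ∀ y z, (Finset.univ.filter fun x => r x y ∧ s x z).card ≤ κ)
    (hN : (Finset.univ.filter fun p : X × Y × Z => r p.1 p.2.1 ∧ s p.1 p.2.2).card ≤ N) :
    frobSq ((Matrix.of fun x y => if r x y then (1 : ℝ) else 0).transpose *
      (Matrix.of fun x z => if s x z then (1 : ℝ) else 0)) ≤ κ * N := by
  have he : ∀ y z, ((Matrix.of fun x y => if r x y then (1 : ℝ) else 0).transpose *
      (Matrix.of fun x z => if s x z then (1 : ℝ) else 0)) y z
        = ((Finset.univ.filter fun x => r x y ∧ s x z).card : ℝ) := by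
    intro y z
    simp only [Matrix.mul_apply, Matrix.transpose_apply, Matrix.of_apply, ite_zero_mul_ite_zero,
      mul_one, Finset.sum_boole]
  have hsum : ∑ y, ∑ z, ((Finset.univ.filter fun x => r x y ∧ s x z).card : ℝ)
      = ((Finset.univ.filter fun p : X × Y × Z => r p.1 p.2.1 ∧ s p.1 p.2.2).card : ℝ) := by
    simp only [Finset.card_filter, Nat.cast_sum, Fintype.sum_prod_type]
    rw [Finset.sum_comm' (t' := Finset.univ) (s' := fun _ => Finset.univ) (by simp)]
    conv_lhs => enter [2, z]; rw [Finset.sum_comm]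
    rw [Finset.sum_comm]
    refine Finset.sum_congr rfl fun x _ => Finset.sum_comm
  calc frobSq _ ≤ ∑ y, ∑ z, (κ : ℝ) * ((Finset.univ.filter fun x => r x y ∧ s x z).card : ℝ) := by
        refine Finset.sum_le_sum fun y _ => Finset.sum_le_sum fun z _ => ?_
        rw [he, sq]
        exact mul_le_mul_of_nonneg_right (by exact_mod_cast hκ y z) (Nat.cast_nonneg _)
    _ = κ * ((Finset.univ.filter fun p : X × Y × Z => r p.1 p.2.1 ∧ s p.1 p.2.2).card : ℝ) := by
        simp only [← Finset.mul_sum, hsum]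
    _ ≤ κ * N := mul_le_mul_of_nonneg_left (by exact_mod_cast hN) (Nat.cast_nonneg _)

/-- The overlap bound for two translations, for configurations glued from a part `u` on `X` and a
part `v` outside `X`. -/
theorem frobSq_translation_overlap_le [NeZero L] {U V : Type*} [Fintype U] [Fintype V]
    [DecidableEq V] {X C : Finset (ZMod L)} {n m : ZMod L}
    (hC : ∀ j, (∀ r : ℕ, j + r • (m - n) ∈ X) → ∃ r : ℕ, j + r • (m - n) ∈ C)
    (g : U → V → RingConfig L d)
    (hU : ∀ u v v', ∀ i ∈ X, g u v i = g u v' i) (hV : ∀ u u' v, ∀ i ∉ X, g u v i = g u' v i)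
    (hg : ∀ u v u' v', g u v = g u' v' → u = u' ∧ v = v') :
    frobSq ((Matrix.of fun (x : U × U) (y : V × V) =>
        if ∀ i, g x.1 y.1 (i + n) = g x.2 y.2 i then (1 : ℝ) else 0).transpose *
      (Matrix.of fun (x : U × U) (y : V × V) =>
        if ∀ i, g x.1 y.1 (i + m) = g x.2 y.2 i then (1 : ℝ) else 0))
      ≤ (Fintype.card V : ℝ) ^ 2 * (d : ℝ) ^ (2 * C.card) := by
  -- Rigidity is applied to the two first-copy configurations, which share the part `x.1`. Their
  -- translates by `n` and `m` share `x.2`, and `z.1`, `y.2` supply the data outside `X`.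
  have key : ∀ (x x' : U × U) (y z y' z' : V × V),
      (∀ i, g x.1 y.1 (i + n) = g x.2 y.2 i) → (∀ i, g x.1 z.1 (i + m) = g x.2 z.2 i) →
      (∀ i, g x'.1 y'.1 (i + n) = g x'.2 y'.2 i) → (∀ i, g x'.1 z'.1 (i + m) = g x'.2 z'.2 i) →
      y.2 = y'.2 → z.1 = z'.1 → (∀ i ∈ C, g x.1 y.1 i = g x'.1 y'.1 i) →
      x = x' ∧ y = y' ∧ z = z' := by
    intro x x' y z y' z' hy hz hy' hz' e₁ e₂ e₃
    obtain ⟨hσ, hτ⟩ := eq_of_agree_outside hC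
      (σ := g x.1 y.1) (τ := g x.1 z.1) (σ' := g x'.1 y'.1) (τ' := g x'.1 z'.1)
      (fun i hi => hU _ _ _ i hi) (fun i hi => by rw [hy, hz]; exact hU _ _ _ i hi)
      (fun i hi => hU _ _ _ i hi) (fun i hi => by rw [hy', hz']; exact hU _ _ _ i hi)
      (fun i hi => by rw [e₂]; exact hV _ _ _ i hi)
      (fun i hi => by rw [hy, hy', e₁]; exact hV _ _ _ i hi) e₃
    have hσ' : g x.2 y.2 = g x'.2 y'.2 := funext fun i => by rw [← hy, ← hy', hσ]
    have hτ' : g x.2 z.2 = g x'.2 z'.2 := funext fun i => by rw [← hz, ← hz', hτ]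
    exact ⟨Prod.ext (hg _ _ _ _ hσ).1 (hg _ _ _ _ hσ').1,
      Prod.ext (hg _ _ _ _ hσ).2 (hg _ _ _ _ hσ').2,
      Prod.ext (hg _ _ _ _ hτ).2 (hg _ _ _ _ hτ').2⟩
  have hcardC : Fintype.card (C → Fin d) = d ^ C.card := by simp
  have h := frobSq_indicator_mul_le
    (fun (x : U × U) (y : V × V) => ∀ i, g x.1 y.1 (i + n) = g x.2 y.2 i)
    (fun (x : U × U) (y : V × V) => ∀ i, g x.1 y.1 (i + m) = g x.2 y.2 i)
    (κ := d ^ C.card) (N := Fintype.card V * Fintype.card V * d ^ C.card) ?_ ?_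
  · refine h.trans (le_of_eq ?_)
    push_cast
    ring
  · intro y z
    rw [← hcardC, ← Finset.card_univ]
    refine Finset.card_le_card_of_injOn (fun x (i : C) => g x.1 y.1 i) (fun _ _ => by simp) ?_
    intro x hx x' hx' hxx
    simp only [Finset.coe_filter, Finset.mem_univ, true_and, Set.mem_ofPred_eq] at hx hx'
    exact (key x x' y z y z hx.1 hx.2 hx'.1 hx'.2 rfl rfl
      fun i hi => congrFun hxx ⟨i, hi⟩).1
  · rw [← hcardC, ← Fintype.card_prod, ← Fintype.card_prod, ← Finset.card_univ]
    refine Finset.card_le_card_of_injOn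
      (fun p => ((p.2.1.2, p.2.2.1), fun i : C => g p.1.1 p.2.1.1 i)) (fun _ _ => by simp) ?_
    rintro ⟨x, y, z⟩ hx ⟨x', y', z'⟩ hx' hxx
    simp only [Finset.coe_filter, Finset.mem_univ, true_and, Set.mem_ofPred_eq] at hx hx'
    simp only [Prod.mk.injEq] at hxx
    obtain ⟨h1, h2, h3⟩ := key x x' y z y' z' hx.1 hx.2 hx'.1 hx'.2 hxx.1.1 hxx.1.2
      fun i hi => congrFun hxx.2 ⟨i, hi⟩
    rw [h1, h2, h3]

end Counting

/-! ### The matrix of a translation across the cut, and its overlaps. -/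

section Blocks

variable {L d : ℕ}

theorem glueConfig_of_mem {A : Finset (ZMod L)} (α : {i // i ∈ A} → Fin d)
    (γ : {i // i ∉ A} → Fin d) {i : ZMod L} (hi : i ∈ A) : glueConfig A α γ i = α ⟨i, hi⟩ := by
  simp [glueConfig, hi]

theorem glueConfig_of_notMem {A : Finset (ZMod L)} (α : {i // i ∈ A} → Fin d)
    (γ : {i // i ∉ A} → Fin d) {i : ZMod L} (hi : i ∉ A) : glueConfig A α γ i = γ ⟨i, hi⟩ := by
  simp [glueConfig, hi]

/-- Gluing as a bijection. -/
def glueEquiv (d : ℕ) (A : Finset (ZMod L)) :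
    (({i // i ∈ A} → Fin d) × ({i // i ∉ A} → Fin d)) ≃ RingConfig L d :=
  (Equiv.piEquivPiSubtypeProd (· ∈ A) fun _ => Fin d).symm

theorem glueConfig_injective {A : Finset (ZMod L)} {α α' : {i // i ∈ A} → Fin d}
    {γ γ' : {i // i ∉ A} → Fin d} (h : glueConfig A α γ = glueConfig A α' γ') :
    α = α' ∧ γ = γ' :=
  Prod.mk.inj ((glueEquiv d A).injective (a₁ := (α, γ)) (a₂ := (α', γ')) h)

/-- Basis labels of the complement of `A` in both copies. -/
abbrev DoubledComplConfig (d : ℕ) (A : Finset (ZMod L)) : Type :=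
  ({i // i ∉ A} → Fin d) × ({i // i ∉ A} → Fin d)

/-- Splitting of a pair of configurations into its parts on `A` and outside `A`. -/
def doubledGlueEquiv (d : ℕ) (A : Finset (ZMod L)) :
    DoubledRegionConfig d A × DoubledComplConfig d A ≃ RingConfig L d × RingConfig L d :=
  (Equiv.prodProdProdComm _ _ _ _).trans ((glueEquiv d A).prodCongr (glueEquiv d A))

theorem doubledGlueEquiv_apply (A : Finset (ZMod L)) (x : DoubledRegionConfig d A)
    (y : DoubledComplConfig d A) :
    doubledGlueEquiv d A (x, y) = (glueConfig A x.1 y.1, glueConfig A x.2 y.2) := rfl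

variable [NeZero L]

/-- The vectorization of `Tⁿ`, as a matrix between the two sides of the bipartition. -/
def translationBlock (d : ℕ) (A : Finset (ZMod L)) (n : ZMod L) :
    Matrix (DoubledRegionConfig d A) (DoubledComplConfig d A) ℝ :=
  Matrix.of fun x y =>
    if ∀ i, glueConfig A x.1 y.1 (i + n) = glueConfig A x.2 y.2 i then 1 else 0

theorem sum_translationBlock_mul (A : Finset (ZMod L)) (n m : ZMod L) :
    (translationBlock d A n * (translationBlock d A m).transpose).trace
      = ((Finset.univ.filter fun σ : RingConfig L d => ∀ i, σ (i + n) = σ (i + m)).card : ℝ) := by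
  simp only [Matrix.trace, Matrix.diag, Matrix.mul_apply, Matrix.transpose_apply,
    translationBlock, Matrix.of_apply, ite_zero_mul_ite_zero, mul_one]
  rw [← Fintype.sum_prod_type', ← (doubledGlueEquiv d A).symm.sum_comp]
  have : ∀ p : RingConfig L d × RingConfig L d,
      (glueConfig A ((doubledGlueEquiv d A).symm p).1.1 ((doubledGlueEquiv d A).symm p).2.1,
        glueConfig A ((doubledGlueEquiv d A).symm p).1.2 ((doubledGlueEquiv d A).symm p).2.2)
        = p := fun p => (doubledGlueEquiv d A).apply_symm_apply p
  have h1 := fun p => congrArg Prod.fst (this p)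
  have h2 := fun p => congrArg Prod.snd (this p)
  simp only at h1 h2
  simp only [h1, h2, Finset.sum_boole]
  congr 1
  refine Finset.card_bij (fun p _ => p.1) ?_ ?_ ?_
  · rintro ⟨σ, τ⟩ h
    simp only [Finset.mem_filter, Finset.mem_univ, true_and] at h ⊢
    exact fun i => (h.1 i).trans (h.2 i).symm
  · rintro ⟨σ, τ⟩ h ⟨σ', τ'⟩ h' e
    simp only [Finset.mem_filter, Finset.mem_univ, true_and] at h h' e
    subst e
    simp only [Prod.mk.injEq, true_and]
    exact funext fun i => (h.1 i).symm.trans (h'.1 i)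
  · intro σ h
    simp only [Finset.mem_filter, Finset.mem_univ, true_and] at h
    exact ⟨(σ, fun i => σ (i + n)), by simpa using fun i => (h i).symm, rfl⟩

theorem trace_translationBlock_self (A : Finset (ZMod L)) (n : ZMod L) :
    (translationBlock d A n * (translationBlock d A n).transpose).trace = (d : ℝ) ^ L := by
  rw [sum_translationBlock_mul]
  simp [ZMod.card]

/-- The trace counts configurations invariant under the nonzero shift `m - n`; these are determined
by one site per orbit, hence by at most half of the ring. -/
theorem trace_translationBlock_mul_sq_le (hd : 1 ≤ d) (A : Finset (ZMod L)) {n m : ZMod L}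
    (h : n ≠ m) :
    (translationBlock d A n * (translationBlock d A m).transpose).trace ^ 2 ≤ (d : ℝ) ^ L := by
  rw [sum_translationBlock_mul]
  obtain ⟨C, hC, hCX⟩ := exists_half_transversal (Finset.univ : Finset (ZMod L))
    (t := m - n) (sub_ne_zero.2 h.symm)
  have hcard : (Finset.univ.filter fun σ : RingConfig L d => ∀ i, σ (i + n) = σ (i + m)).card
      ≤ d ^ C.card := by
    have : Fintype.card (C → Fin d) = d ^ C.card := by simp
    rw [← this, ← Finset.card_univ]
    refine Finset.card_le_card_of_injOn (fun σ (i : C) => σ i) (fun _ _ => by simp) ?_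
    intro σ hσ σ' hσ' e
    simp only [Finset.coe_filter, Finset.mem_univ, true_and, Set.mem_ofPred_eq] at hσ hσ'
    exact (eq_of_agree_outside (X := Finset.univ) (n := n) (m := m) hCX (fun i _ => rfl)
      (fun i _ => hσ i) (fun i _ => rfl) (fun i _ => hσ' i) (by simp) (by simp)
      fun i hi => congrFun e ⟨i, hi⟩).1
  rw [Finset.card_univ, ZMod.card] at hC
  calc _ ≤ ((d ^ C.card : ℕ) : ℝ) ^ 2 := by gcongr
    _ = (d : ℝ) ^ (2 * C.card) := by push_cast; ring
    _ ≤ (d : ℝ) ^ L := pow_le_pow_right₀ (by exact_mod_cast hd) hC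

/-- No orbit stays inside the interval, so the overlap bound applies with `C = ∅`. -/
theorem frobSq_transpose_translationBlock_mul_le {A : Finset (ZMod L)} (hA : IsRingInterval A)
    (hL : 2 * A.card ≤ L) {n m : ZMod L} (h : n ≠ m) :
    frobSq ((translationBlock d A n).transpose * translationBlock d A m)
      ≤ (d : ℝ) ^ (2 * (L - A.card)) := by
  obtain ⟨s, hs⟩ := hA.exists_mem_iff hL
  have := frobSq_translation_overlap_le (X := A) (C := ∅) (n := n) (m := m) (d := d)
    (fun j hj => by
      obtain ⟨r, hr⟩ := exists_orbit_notMem (sub_ne_zero.2 h.symm) hL hs j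
      exact absurd (hj r) hr)
    (glueConfig A) (fun u v v' i hi => by simp only [glueConfig_of_mem _ _ hi])
    (fun u u' v i hi => by simp only [glueConfig_of_notMem _ _ hi])
    (fun u v u' v' e => glueConfig_injective e)
  refine this.trans (le_of_eq ?_)
  have hc : Fintype.card ({i // i ∉ A} → Fin d) = d ^ (L - A.card) := by
    simp [Fintype.card_subtype_compl, ZMod.card]
  rw [hc]
  push_cast
  simp only [Finset.card_empty]
  ring

/-- The complement of `A` may contain whole orbits, so a half transversal of it is needed: `2|A| +
(L - |A|) = L + |A|`. -/
theorem frobSq_translationBlock_mul_transpose_le (hd : 1 ≤ d) {A : Finset (ZMod L)}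
    (hL : 2 * A.card ≤ L) {n m : ZMod L} (h : n ≠ m) :
    frobSq (translationBlock d A n * (translationBlock d A m).transpose)
      ≤ (d : ℝ) ^ (L + A.card) := by
  obtain ⟨C, hC, hCX⟩ := exists_half_transversal Aᶜ (t := m - n) (sub_ne_zero.2 h.symm)
  have := frobSq_translation_overlap_le (X := Aᶜ) (C := C) (n := n) (m := m) (d := d) hCX
    (fun γ α => glueConfig A α γ)
    (fun u v v' i hi => by simp only [glueConfig_of_notMem _ _ (Finset.mem_compl.1 hi)])
    (fun u u' v i hi => by
      simp only [glueConfig_of_mem _ _ (show i ∈ A by simpa using hi)])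
    (fun u v u' v' e => (glueConfig_injective e).symm)
  refine this.trans ?_
  have hc : Fintype.card ({i // i ∈ A} → Fin d) = d ^ A.card := by simp
  rw [hc, Nat.cast_pow, ← pow_mul, ← pow_add]
  rw [Finset.card_compl, ZMod.card] at hC
  exact pow_le_pow_right₀ (by exact_mod_cast hd) (by omega)

/-- The vectorization of a translation is proportional to a partial isometry. -/
theorem translationBlock_mul_transpose_mul (A : Finset (ZMod L)) (n : ZMod L) :
    translationBlock d A n * (translationBlock d A n).transpose * translationBlock d A n
      = (d : ℝ) ^ (Finset.univ.filter fun i => i ∈ A ↔ i + n ∈ A).card •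
        translationBlock d A n := by
  ext x y
  have he : (translationBlock d A n * (translationBlock d A n).transpose *
      translationBlock d A n) x y = ((Finset.univ.filter
        fun p : DoubledRegionConfig d A × DoubledComplConfig d A =>
          ((∀ i, glueConfig A x.1 p.2.1 (i + n) = glueConfig A x.2 p.2.2 i) ∧
          (∀ i, glueConfig A p.1.1 p.2.1 (i + n) = glueConfig A p.1.2 p.2.2 i)) ∧
          (∀ i, glueConfig A p.1.1 y.1 (i + n) = glueConfig A p.1.2 y.2 i)).card : ℝ) := by
    simp only [Matrix.mul_apply, Finset.sum_mul, Matrix.transpose_apply,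
      translationBlock, Matrix.of_apply, ite_zero_mul_ite_zero, mul_one]
    rw [← Fintype.sum_prod_type', Finset.sum_boole]
  rw [he, Matrix.smul_apply, smul_eq_mul]
  simp only [translationBlock, Matrix.of_apply]
  split_ifs with hxy
  · rw [mul_one]
    -- The intermediate pair is determined by its second-copy configuration, which is forced at the
    -- sites crossing the cut and free elsewhere.
    have hpi : (Fintype.piFinset fun i => if (i ∈ A ↔ i + n ∈ A) then Finset.univ
        else {glueConfig A x.2 y.2 i}).card
        = d ^ (Finset.univ.filter fun i => i ∈ A ↔ i + n ∈ A).card := by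
      rw [Fintype.card_piFinset]
      simp only [apply_ite Finset.card, Finset.card_univ, Fintype.card_fin,
        Finset.card_singleton, Finset.prod_ite, Finset.prod_const, one_pow, mul_one]
    rw [← Nat.cast_pow, ← hpi]
    congr 1
    refine Finset.card_bij (fun p _ => glueConfig A p.1.2 p.2.2) ?_ ?_ ?_
    · rintro ⟨x', y'⟩ h
      simp only [Finset.mem_filter, Finset.mem_univ, true_and] at h
      obtain ⟨⟨h1, h2⟩, h3⟩ := h
      rw [Fintype.mem_piFinset]
      intro i
      have a1 := h1 i
      have a3 := h3 i
      have a4 := hxy i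
      by_cases hi : i ∈ A <;> by_cases hin : i + n ∈ A <;>
        simp_all [glueConfig_of_mem, glueConfig_of_notMem]
    · rintro ⟨x', y'⟩ h ⟨x'', y''⟩ h' e
      simp only [Finset.mem_filter, Finset.mem_univ, true_and] at h h' e
      have e2 : glueConfig A x'.1 y'.1 = glueConfig A x''.1 y''.1 := by
        funext i
        have b := h.1.2 (i - n)
        have b' := h'.1.2 (i - n)
        rw [sub_add_cancel] at b b'
        rw [b, b', e]
      exact Prod.ext (Prod.ext (glueConfig_injective e2).1 (glueConfig_injective e).1)
        (Prod.ext (glueConfig_injective e2).2 (glueConfig_injective e).2)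
    · intro ρ hρ
      rw [Fintype.mem_piFinset] at hρ
      refine ⟨((fun i => ρ (i - n), fun i => ρ i), (fun i => ρ (i - n), fun i => ρ i)), ?_, ?_⟩
      · simp only [Finset.mem_filter, Finset.mem_univ, true_and]
        refine ⟨⟨fun i => ?_, fun i => ?_⟩, fun i => ?_⟩ <;>
        · have a := hρ i
          have a4 := hxy i
          by_cases hi : i ∈ A <;> by_cases hin : i + n ∈ A <;>
            simp_all [glueConfig_of_mem, glueConfig_of_notMem]
      · funext i
        by_cases hi : i ∈ A <;> simp [glueConfig, hi]
  -- The three relations chain together to force the relation between `x` and `y`, so a vanishing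
  -- entry stays zero.
  · rw [mul_zero, Nat.cast_eq_zero, Finset.card_eq_zero, Finset.filter_eq_empty_iff]
    rintro p - ⟨⟨h1, h2⟩, h3⟩
    refine hxy fun i => ?_
    have a1 := h1 i
    have a2 := h2 i
    have a3 := h3 i
    by_cases hi : i ∈ A <;> by_cases hin : i + n ∈ A <;>
      simp only [glueConfig_of_mem, glueConfig_of_notMem, hi, hin, not_false_eq_true]
        at a1 a2 a3 ⊢
    · exact a1
    · exact a3.trans (a2.symm.trans a1)
    · exact a1.trans (a2.symm.trans a3)
    · exact a3

end Blocks

/-! ### Moments of the sum of translations. -/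

theorem rpow_neg_half_sq {L d : ℕ} (hd : 1 ≤ d) :
    ((d : ℝ) ^ (-((L : ℝ) / 2))) ^ 2 = ((d : ℝ) ^ L)⁻¹ := by
  have hd0 : (0 : ℝ) < d := by exact_mod_cast hd
  rw [← Real.rpow_natCast, ← Real.rpow_mul hd0.le, ← Real.rpow_natCast, ← Real.rpow_neg hd0.le]
  congr 1
  push_cast
  ring

section Spectrum

variable {L d : ℕ} [NeZero L]

theorem frobSq_smul {m n : Type*} [Fintype m] [Fintype n] (c : ℝ) (X : Matrix m n ℝ) :
    frobSq (c • X) = c ^ 2 * frobSq X := by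
  simp only [frobSq, Matrix.smul_apply, smul_eq_mul, mul_pow, Finset.mul_sum]

/-- The error scale `d^(-2|A|) + d^(-L/2)`. -/
noncomputable def overlapScale (L d a : ℕ) : ℝ :=
  (d : ℝ) ^ (-(2 * (a : ℝ))) + (d : ℝ) ^ (-((L : ℝ) / 2))

/-- The weight `Tr ρ_n^k` of the reduced state of a single translation. -/
noncomputable def crossingWeight (d k : ℕ) (A : Finset (ZMod L)) (n : ZMod L) : ℝ :=
  (((d : ℝ) ^ (Finset.univ.filter fun i => ¬(i ∈ A ↔ i + n ∈ A)).card)⁻¹) ^ (k - 1)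

theorem abs_trace_translationBlock_mul_le (hd : 1 ≤ d) (A : Finset (ZMod L)) {n m : ZMod L}
    (h : n ≠ m) :
    |(translationBlock d A n * (translationBlock d A m).transpose).trace|
      ≤ (d : ℝ) ^ (-((L : ℝ) / 2)) * (d : ℝ) ^ L := by
  have hd0 : (0 : ℝ) < d := by exact_mod_cast hd
  apply abs_le_of_sq_le_sq _ (by positivity)
  rw [mul_pow, rpow_neg_half_sq hd]
  refine (trace_translationBlock_mul_sq_le hd A h).trans (le_of_eq ?_)
  field_simp

/-- With `v n = d^(-L/2) V_n` the overlap bounds become `d^(-2|A|)` and `d^(-(L-|A|))`, the latter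
at most `d^(-L/2)` since `|A| ≤ L/2`. -/
theorem trace_block_sum_pow_bounds {k : ℕ} (hd : 1 ≤ d) (hk : 2 ≤ k) {A : Finset (ZMod L)}
    (hA : IsRingInterval A) (hL : 2 * A.card ≤ L) :
    ∑ n, crossingWeight d k A n
        ≤ (((∑ n, translationBlock d A n) * (∑ n, translationBlock d A n).transpose) ^ k).trace
          / ((d : ℝ) ^ L) ^ k ∧
      (((∑ n, translationBlock d A n) * (∑ n, translationBlock d A n).transpose) ^ k).trace
          / ((d : ℝ) ^ L) ^ k
        ≤ ∑ n, crossingWeight d k A n + (L : ℝ) ^ (2 * k) * overlapScale L d A.card := by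
  have hd0 : (0 : ℝ) < d := by exact_mod_cast hd
  have hd1 : (1 : ℝ) ≤ d := by exact_mod_cast hd
  set κ : ℝ := (d : ℝ) ^ (-((L : ℝ) / 2)) with hκ
  have hκ0 : 0 < κ := Real.rpow_pos_of_pos hd0 _
  have hκ2 : κ ^ 2 = ((d : ℝ) ^ L)⁻¹ := rpow_neg_half_sq hd
  set c : ZMod L → ℝ := fun n =>
    ((d : ℝ) ^ (Finset.univ.filter fun i => ¬(i ∈ A ↔ i + n ∈ A)).card)⁻¹ with hc
  have hc0 : ∀ n, 0 < c n := fun n => by positivity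
  have hc1 : ∀ n, c n ≤ 1 := fun n => inv_le_one_of_one_le₀ (one_le_pow₀ hd1)
  set v : ZMod L → Matrix (DoubledRegionConfig d A) (DoubledComplConfig d A) ℝ :=
    fun n => κ • translationBlock d A n with hv
  have hv3 : ∀ n, v n * (v n).transpose * v n = c n • v n := by
    intro n
    have hcard := Finset.card_filter_add_card_filter_not (s := (Finset.univ : Finset (ZMod L)))
      (fun i => i ∈ A ↔ i + n ∈ A)
    rw [Finset.card_univ, ZMod.card] at hcard
    simp only [hv, hc, Matrix.transpose_smul, Matrix.smul_mul, Matrix.mul_smul,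
      translationBlock_mul_transpose_mul, smul_smul]
    congr 1
    rw [show κ * (κ * κ * (d : ℝ) ^ (Finset.univ.filter fun i => i ∈ A ↔ i + n ∈ A).card)
      = κ ^ 2 * (d : ℝ) ^ (Finset.univ.filter fun i => i ∈ A ↔ i + n ∈ A).card * κ by ring, hκ2]
    congr 1
    rw [show (d : ℝ) ^ L = (d : ℝ) ^ (Finset.univ.filter fun i => i ∈ A ↔ i + n ∈ A).card *
      (d : ℝ) ^ (Finset.univ.filter fun i => ¬(i ∈ A ↔ i + n ∈ A)).card by
        rw [← pow_add]; exact congrArg _ hcard.symm]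
    field_simp
  have hε : overlapScale L d A.card = (d : ℝ) ^ (-(2 * (A.card : ℝ))) + κ := rfl
  have hε0 : 0 ≤ overlapScale L d A.card := by rw [hε]; positivity
  have htr : ∀ n m, (v n * (v m).transpose).trace
      = κ ^ 2 * (translationBlock d A n * (translationBlock d A m).transpose).trace := by
    intro n m
    simp only [hv, Matrix.transpose_smul, Matrix.smul_mul, Matrix.mul_smul, Matrix.trace_smul,
      smul_eq_mul]
    ring
  have hp0 : 0 < (d : ℝ) ^ (-(2 * (A.card : ℝ))) := Real.rpow_pos_of_pos hd0 _
  have hmain := trace_sum_mul_transpose_pow_bounds (v := v) (c := c) (k := k)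
    (ε := overlapScale L d A.card) hk hε0 ?_ hc0 hc1 hv3 ?_ ?_ ?_
  · have hsum : (((∑ n, v n) * (∑ n, v n).transpose) ^ k).trace
        = (((∑ n, translationBlock d A n) *
          (∑ n, translationBlock d A n).transpose) ^ k).trace / ((d : ℝ) ^ L) ^ k := by
      simp only [hv, ← Finset.smul_sum, Matrix.transpose_smul, Matrix.smul_mul, Matrix.mul_smul,
        smul_smul, smul_pow, Matrix.trace_smul, smul_eq_mul]
      rw [← sq, hκ2, inv_pow, div_eq_inv_mul]
    rw [hsum, ZMod.card] at hmain
    exact hmain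
  · intro n x y
    simp only [hv, Matrix.smul_apply, translationBlock, Matrix.of_apply, smul_eq_mul]
    split_ifs <;> simp [hκ0.le]
  · intro n
    rw [htr, trace_translationBlock_self, hκ2, inv_mul_cancel₀ (by positivity)]
  · intro n m hnm
    have e1 : frobSq (v n * (v m).transpose) ≤ κ := by
      have := frobSq_translationBlock_mul_transpose_le (d := d) hd hL hnm
      simp only [hv, Matrix.transpose_smul, Matrix.smul_mul, Matrix.mul_smul, smul_smul,
        frobSq_smul]
      rw [← sq, hκ2]
      calc (((d : ℝ) ^ L)⁻¹) ^ 2 * frobSq _ ≤ (((d : ℝ) ^ L)⁻¹) ^ 2 * (d : ℝ) ^ (L + A.card) := by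
            gcongr
        _ = (d : ℝ) ^ (-((L : ℝ) - A.card)) := by
            rw [neg_sub, Real.rpow_sub hd0, Real.rpow_natCast, Real.rpow_natCast, pow_add]
            field_simp
        _ ≤ κ := by
            apply Real.rpow_le_rpow_of_exponent_le hd1
            have : (2 : ℝ) * A.card ≤ L := by exact_mod_cast hL
            linarith
    have e2 : frobSq ((v n).transpose * v m) ≤ (d : ℝ) ^ (-(2 * (A.card : ℝ))) := by
      have := frobSq_transpose_translationBlock_mul_le (d := d) hA hL hnm
      simp only [hv, Matrix.transpose_smul, Matrix.smul_mul, Matrix.mul_smul, smul_smul,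
        frobSq_smul]
      rw [← sq, hκ2]
      calc (((d : ℝ) ^ L)⁻¹) ^ 2 * frobSq _
          ≤ (((d : ℝ) ^ L)⁻¹) ^ 2 * (d : ℝ) ^ (2 * (L - A.card)) := by gcongr
        _ = (d : ℝ) ^ (-(2 * (A.card : ℝ))) := by
            have hsplit : (d : ℝ) ^ L = (d : ℝ) ^ (L - A.card) * (d : ℝ) ^ A.card := by
              rw [← pow_add]
              congr 1
              omega
            rw [Real.rpow_neg hd0.le, show (2 : ℝ) * A.card = ((2 * A.card : ℕ) : ℝ) by push_cast; rfl,
              Real.rpow_natCast, hsplit, pow_mul', pow_mul']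
            field_simp
    linarith
  · intro n m hnm
    rw [htr, abs_mul, abs_of_pos (pow_pos hκ0 2), hκ2, inv_mul_le_iff₀ (by positivity)]
    refine (abs_trace_translationBlock_mul_le (d := d) hd A hnm).trans ?_
    rw [mul_comm]
    exact mul_le_mul_of_nonneg_left (by linarith) (by positivity)

theorem trace_block_sum_bounds (hd : 1 ≤ d) (A : Finset (ZMod L)) :
    1 ≤ ((∑ n, translationBlock d A n) * (∑ n, translationBlock d A n).transpose).trace
        / (L * (d : ℝ) ^ L) ∧
      ((∑ n, translationBlock d A n) * (∑ n, translationBlock d A n).transpose).trace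
        / (L * (d : ℝ) ^ L) ≤ 1 + L * (d : ℝ) ^ (-((L : ℝ) / 2)) := by
  have hd0 : (0 : ℝ) < d := by exact_mod_cast hd
  have hL0 : (0 : ℝ) < L := by exact_mod_cast NeZero.pos L
  have e : ((∑ n, translationBlock d A n) * (∑ n, translationBlock d A n).transpose).trace
      = ∑ n, ∑ m, (translationBlock d A n * (translationBlock d A m).transpose).trace := by
    rw [Matrix.transpose_sum, Matrix.sum_mul, Matrix.trace_sum]
    simp only [Matrix.mul_sum, Matrix.trace_sum]
  rw [e, one_le_div (by positivity), div_le_iff₀ (by positivity)]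
  have hcard : ((Finset.univ : Finset (ZMod L)).card : ℝ) = L := by
    rw [Finset.card_univ, ZMod.card]
  constructor
  · calc (L : ℝ) * (d : ℝ) ^ L = ∑ _n : ZMod L, (d : ℝ) ^ L := by
          rw [Finset.sum_const, nsmul_eq_mul, hcard]
      _ ≤ _ := by
          refine Finset.sum_le_sum fun n _ => ?_
          rw [← trace_translationBlock_self (d := d) A n]
          refine Finset.single_le_sum (f := fun m =>
            (translationBlock d A n * (translationBlock d A m).transpose).trace)
            (fun m _ => ?_) (Finset.mem_univ n)
          rw [sum_translationBlock_mul]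
          positivity
  · calc _ ≤ ∑ n : ZMod L, ∑ m : ZMod L, ((if n = m then (d : ℝ) ^ L else 0) +
            (d : ℝ) ^ (-((L : ℝ) / 2)) * (d : ℝ) ^ L) := by
          refine Finset.sum_le_sum fun n _ => Finset.sum_le_sum fun m _ => ?_
          split_ifs with h
          · rw [h, trace_translationBlock_self]
            exact le_add_of_nonneg_right (by positivity)
          · rw [zero_add]
            exact (le_abs_self _).trans (abs_trace_translationBlock_mul_le hd A h)
      _ = _ := by
          simp only [Finset.sum_add_distrib, Finset.sum_ite_eq, Finset.mem_univ, if_true,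
            Finset.sum_const, nsmul_eq_mul, hcard]
          ring

theorem sum_crossingWeight_bounds {k : ℕ} (hd : 2 ≤ d) (hk : 2 ≤ k) {A : Finset (ZMod L)}
    (hA : IsRingInterval A) (hL : 2 * A.card ≤ L) :
    1 ≤ ∑ n, crossingWeight d k A n ∧
      |∑ n, crossingWeight d k A n
        - (1 + ((d : ℝ) ^ (2 * (k - 1)))⁻¹) / (1 - ((d : ℝ) ^ (2 * (k - 1)))⁻¹)|
        ≤ (L + 2) * (((d : ℝ) ^ (2 * (k - 1)))⁻¹) ^ A.card := by
  obtain ⟨s, hs⟩ := hA.exists_mem_iff hL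
  have hd2 : (2 : ℝ) ≤ d := by exact_mod_cast hd
  set x : ℝ := ((d : ℝ) ^ (2 * (k - 1)))⁻¹ with hx
  have hx0 : 0 < x := by positivity
  have hx4 : x ≤ 1 / 4 := by
    rw [hx, one_div]
    apply inv_anti₀ (by norm_num)
    calc (4 : ℝ) = 2 ^ 2 := by norm_num
      _ ≤ (d : ℝ) ^ 2 := by gcongr
      _ ≤ (d : ℝ) ^ (2 * (k - 1)) := pow_le_pow_right₀ (by linarith) (by omega)
  have hw : ∀ n : ZMod L, crossingWeight d k A n = x ^ min n.val (min (L - n.val) A.card) := by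
    intro n
    rw [crossingWeight, card_crossing hL hs, hx, inv_pow, inv_pow, ← pow_mul, ← pow_mul]
    congr 2
    ring
  have hsum : ∑ n, crossingWeight d k A n
      = ∑ j ∈ Finset.range L, x ^ min j (min (L - j) A.card) := by
    simp only [hw]
    refine Finset.sum_bij (fun n _ => n.val) (fun n _ => Finset.mem_range.2 (ZMod.val_lt n))
      (fun n _ m _ h => ZMod.val_injective L h) (fun j hj => ⟨j, Finset.mem_univ _,
        ZMod.val_natCast_of_lt (Finset.mem_range.1 hj)⟩) (fun _ _ => rfl)
  rw [hsum]
  have hmono : ∀ {i j : ℕ}, i ≤ j → x ^ j ≤ x ^ i :=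
    fun h => pow_le_pow_of_le_one hx0.le (by linarith) h
  constructor
  · have := Finset.single_le_sum (f := fun j => x ^ min j (min (L - j) A.card))
      (fun j _ => by positivity) (Finset.mem_range.2 (NeZero.pos L))
    simpa using this
  -- The minimum is replaced by two independent tails, one from each direction around the ring. This
  -- costs at most `x ^ A.card` per term, and the final factor `1 - x ^ L` accounts for the `+ 2` in
  -- the bound.
  · have hgeom : ∑ j ∈ Finset.range L, (x ^ j + x ^ (L - j)) = (1 + x) / (1 - x) * (1 - x ^ L) := by
      have h1 : ∑ j ∈ Finset.range L, x ^ (L - j) = x * ∑ j ∈ Finset.range L, x ^ j := by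
        rw [← Finset.sum_range_reflect, Finset.mul_sum]
        refine Finset.sum_congr rfl fun j hj => ?_
        rw [← pow_succ']
        congr 1
        have := Finset.mem_range.1 hj
        omega
      rw [Finset.sum_add_distrib, h1, geom_sum_eq (by linarith)]
      have : 1 - x ≠ 0 := by linarith
      have : x - 1 ≠ 0 := by linarith
      field_simp
      ring
    have hpt : ∀ j ∈ Finset.range L, |x ^ min j (min (L - j) A.card) - (x ^ j + x ^ (L - j))|
        ≤ x ^ A.card := by
      intro j hj
      have hj := Finset.mem_range.1 hj
      have p1 : 0 < x ^ j := by positivity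
      have p2 : 0 < x ^ (L - j) := by positivity
      have p3 : 0 < x ^ A.card := by positivity
      rw [abs_le]
      rcases le_total j A.card with h1 | h1
      · rw [show min j (min (L - j) A.card) = j by omega]
        have := hmono (show A.card ≤ L - j by omega)
        constructor <;> linarith
      · rcases le_total (L - j) A.card with h2 | h2
        · rw [show min j (min (L - j) A.card) = L - j by omega]
          have := hmono h1
          constructor <;> linarith
        · rw [show min j (min (L - j) A.card) = A.card by omega]
          have := hmono h1
          have := hmono h2
          constructor <;> linarith
    have h1 : |∑ j ∈ Finset.range L, x ^ min j (min (L - j) A.card)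
        - (1 + x) / (1 - x) * (1 - x ^ L)| ≤ L * x ^ A.card := by
      rw [← hgeom, ← Finset.sum_sub_distrib]
      refine (Finset.abs_sum_le_sum_abs _ _).trans ((Finset.sum_le_sum hpt).trans (le_of_eq ?_))
      simp
    have hX : (1 + x) / (1 - x) ≤ 2 := by
      rw [div_le_iff₀ (by linarith)]
      linarith
    have hX0 : 0 ≤ (1 + x) / (1 - x) := div_nonneg (by linarith) (by linarith)
    have h2 : (1 + x) / (1 - x) * x ^ L ≤ 2 * x ^ A.card :=
      mul_le_mul hX (hmono (by omega)) (by positivity) (by norm_num)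
    have h3 : 0 ≤ (1 + x) / (1 - x) * x ^ L := by positivity
    rw [abs_le] at h1 ⊢
    constructor <;> linarith [h1.1, h1.2]

end Spectrum

/-! ### From moments to the entropy. -/

section Entropy

variable {L d : ℕ} [NeZero L]

theorem translationOp_pow_apply (n : ℕ) (τ σ : RingConfig L d) :
    (translationOp L d ^ n) τ σ = if ∀ i, τ (i + n) = σ i then 1 else 0 := by
  induction n generalizing τ σ with
  | zero =>
    simp only [pow_zero, Matrix.one_apply, Nat.cast_zero, add_zero, funext_iff]
  | succ n ih =>
    rw [pow_succ', Matrix.mul_apply, Finset.sum_eq_single (fun i => τ (i + 1))]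
    · rw [ih]
      simp only [translationOp, Matrix.of_apply, implies_true, if_true, one_mul]
      congr 1
      simp only [Nat.cast_add, Nat.cast_one, add_assoc]
    · intro ρ _ hρ
      rw [translationOp, Matrix.of_apply, if_neg, zero_mul]
      exact fun h => hρ (funext fun i => (h i).symm)
    · simp

/-- The number of translations that send `σ` to `τ`. -/
def translationCount (L d : ℕ) [NeZero L] : Matrix (RingConfig L d) (RingConfig L d) ℝ :=
  Matrix.of fun τ σ => ∑ n : ZMod L, if ∀ i, τ (i + n) = σ i then 1 else 0

theorem translationProjector_apply (τ σ : RingConfig L d) :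
    translationProjector L d τ σ = (L : ℂ)⁻¹ * (translationCount L d τ σ : ℂ) := by
  rw [translationProjector, Matrix.smul_apply, Matrix.sum_apply, smul_eq_mul, translationCount,
    Matrix.of_apply]
  congr 1
  push_cast
  simp only [translationOp_pow_apply]
  refine Finset.sum_bij (fun n _ => (n : ZMod L)) (fun _ _ => Finset.mem_univ _) ?_ ?_ ?_
  · intro i hi j hj h
    rw [ZMod.natCast_eq_natCast_iff'] at h
    rwa [Nat.mod_eq_of_lt (Finset.mem_range.1 hi), Nat.mod_eq_of_lt (Finset.mem_range.1 hj)] at h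
  · exact fun n _ => ⟨n.val, Finset.mem_range.2 (ZMod.val_lt n), by simp⟩
  · intro n _
    split_ifs <;> simp

theorem trace_translationProjector_ne_zero (hd : 1 ≤ d) :
    (translationProjector L d).trace ≠ 0 := by
  have hL : (L : ℂ) ≠ 0 := by exact_mod_cast NeZero.ne L
  have e : (translationProjector L d).trace
      = (L : ℂ)⁻¹ * ((∑ σ, translationCount L d σ σ : ℝ) : ℂ) := by
    simp only [Matrix.trace, Matrix.diag, translationProjector_apply, ← Finset.mul_sum]
    push_cast
    rfl
  rw [e]
  refine mul_ne_zero (inv_ne_zero hL) (Complex.ofReal_ne_zero.2 (ne_of_gt ?_))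
  have : Nonempty (Fin d) := ⟨⟨0, hd⟩⟩
  refine Finset.sum_pos (fun σ _ => ?_) Finset.univ_nonempty
  rw [translationCount, Matrix.of_apply]
  refine Finset.sum_pos' (fun n _ => by split_ifs <;> norm_num) ⟨0, Finset.mem_univ _, ?_⟩
  simp

theorem translationMMIS_apply (τ σ : RingConfig L d) :
    translationMMIS L d τ σ = ((translationProjector L d).trace⁻¹ * (L : ℂ)⁻¹) *
      (translationCount L d τ σ : ℂ) := by
  rw [translationMMIS, Matrix.smul_apply, translationProjector_apply, smul_eq_mul, mul_assoc]

theorem translationCount_glue (A : Finset (ZMod L)) (x : DoubledRegionConfig d A)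
    (y : DoubledComplConfig d A) :
    translationCount L d (glueConfig A x.1 y.1) (glueConfig A x.2 y.2)
      = (∑ n, translationBlock d A n) x y := by
  simp only [translationCount, Matrix.sum_apply, translationBlock, Matrix.of_apply]

theorem frobSq_translationCount (A : Finset (ZMod L)) :
    ∑ y : RingConfig L d × RingConfig L d, translationCount L d y.1 y.2 ^ 2
      = ((∑ n, translationBlock d A n) * (∑ n, translationBlock d A n).transpose).trace := by
  rw [← (doubledGlueEquiv d A).sum_comp, Fintype.sum_prod_type]
  simp only [doubledGlueEquiv_apply, translationCount_glue, Matrix.trace, Matrix.diag,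
    Matrix.mul_apply, Matrix.transpose_apply, sq]

/-- The scalar `c` enters only through `|c|²`, which the normalization cancels; the trace of the
projector therefore never has to be computed. -/
theorem doubledState_mul_star {ι : Type*} [Fintype ι] {M : Matrix ι ι ℂ} {N : Matrix ι ι ℝ}
    {c : ℂ} (hc : c ≠ 0) (h : ∀ i j, M i j = c * (N i j : ℂ)) (x y : ι × ι) :
    doubledState M x * star (doubledState M y)
      = (((∑ z : ι × ι, N z.1 z.2 ^ 2)⁻¹ * (N x.1 x.2 * N y.1 y.2) : ℝ) : ℂ) := by
  have hs : ∑ y : ι × ι, ‖M y.1 y.2‖ ^ 2 = ‖c‖ ^ 2 * ∑ z : ι × ι, N z.1 z.2 ^ 2 := by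
    simp only [h, norm_mul, mul_pow, Complex.norm_real, Real.norm_eq_abs, sq_abs, Finset.mul_sum]
  have h0 : 0 ≤ ‖c‖ ^ 2 * ∑ z : ι × ι, N z.1 z.2 ^ 2 := by positivity
  simp only [doubledState, hs]
  simp only [h, star_div₀, star_mul', Complex.star_def, Complex.conj_ofReal]
  rw [div_mul_div_comm, ← Complex.ofReal_mul, Real.mul_self_sqrt h0]
  have e : c * (N x.1 x.2 : ℂ) * ((starRingEnd ℂ) c * (N y.1 y.2 : ℂ))
      = ((‖c‖ ^ 2 : ℝ) : ℂ) * ((N x.1 x.2 * N y.1 y.2 : ℝ) : ℂ) := by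
    rw [Complex.ofReal_pow, ← Complex.mul_conj']
    push_cast
    ring
  rw [e, ← Complex.ofReal_mul, ← Complex.ofReal_div]
  congr 1
  have : ‖c‖ ^ 2 ≠ 0 := by simpa using hc
  rw [mul_div_mul_left _ _ this, div_eq_inv_mul]

theorem doubledReducedDensity_translationMMIS (hd : 1 ≤ d) (A : Finset (ZMod L)) :
    doubledReducedDensity A (translationMMIS L d)
      = ((((∑ n, translationBlock d A n) * (∑ n, translationBlock d A n).transpose).trace)⁻¹ •
          ((∑ n, translationBlock d A n) * (∑ n, translationBlock d A n).transpose)).map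
        Complex.ofRealHom := by
  have hL : (L : ℂ) ≠ 0 := by exact_mod_cast NeZero.ne L
  ext x y
  simp only [doubledReducedDensity, partialTraceDoubled, Matrix.of_apply, Matrix.vecMulVec_apply,
    Pi.star_apply]
  simp only [doubledState_mul_star
    (mul_ne_zero (inv_ne_zero (trace_translationProjector_ne_zero (L := L) hd)) (inv_ne_zero hL))
    translationMMIS_apply, frobSq_translationCount A]
  rw [← Fintype.sum_prod_type', Matrix.map_apply, Complex.ofRealHom_eq_coe, ← Complex.ofReal_sum,
    ← Finset.mul_sum, Matrix.smul_apply, smul_eq_mul, Matrix.mul_apply]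
  congr 2
  refine Finset.sum_congr rfl fun z _ => ?_
  rw [translationCount_glue A x z, translationCount_glue A y z, Matrix.transpose_apply]

theorem renyiOSE_translationMMIS (k : ℕ) (hd : 1 ≤ d) (A : Finset (ZMod L)) :
    renyiOSE k A (translationMMIS L d) = 1 / (1 - (k : ℝ)) * Real.log
      ((((∑ n, translationBlock d A n) * (∑ n, translationBlock d A n).transpose) ^ k).trace /
        ((∑ n, translationBlock d A n) * (∑ n, translationBlock d A n).transpose).trace ^ k) := by
  rw [renyiOSE, renyiEntropy, doubledReducedDensity_translationMMIS hd, ← Matrix.map_pow,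
    ← AddMonoidHom.map_trace, Complex.ofRealHom_eq_coe, Complex.ofReal_re, smul_pow,
    Matrix.trace_smul, smul_eq_mul, inv_pow, mul_comm (_ ^ k)⁻¹,
    ← div_eq_mul_inv]

theorem abs_log_sub_log_le {x y : ℝ} (hx : 1 ≤ x) (hy : 1 ≤ y) :
    |Real.log x - Real.log y| ≤ |x - y| := by
  wlog h : y ≤ x generalizing x y
  · rw [abs_sub_comm, abs_sub_comm x]
    exact this hy hx (le_of_not_ge h)
  rw [abs_of_nonneg (sub_nonneg.2 (Real.log_le_log (by linarith) h)),
    abs_of_nonneg (sub_nonneg.2 h), ← Real.log_div (by linarith) (by linarith)]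
  refine (Real.log_le_sub_one_of_pos (by positivity)).trans ?_
  rw [div_sub_one (by linarith)]
  exact div_le_self (sub_nonneg.2 h) hy

/-- The asymptotic Rényi entropy. -/
noncomputable def asymptoticEntropy (L d k : ℕ) : ℝ :=
  (k : ℝ) / ((k : ℝ) - 1) * Real.log L -
    1 / ((k : ℝ) - 1) *
      Real.log ((1 + ((d : ℝ) ^ (2 * (k - 1)))⁻¹) / (1 - ((d : ℝ) ^ (2 * (k - 1)))⁻¹))

/-- `Tr R_A^k = Q / (G L)^k` with `Q` near `X` and `G` near `1`. Since `Q`, `G` and `X` are all at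
least one, logarithms do not enlarge the errors. In `k + 4`, the geometric sum costs `3` (from `L +
2 ≤ 3 L^(2k)`), the mixed words `1`, and the normalization `k`. -/
theorem abs_renyiOSE_sub_le {k : ℕ} (hd : 2 ≤ d) (hk : 2 ≤ k) {A : Finset (ZMod L)}
    (hA : IsRingInterval A) (hL : 2 * A.card ≤ L) :
    |renyiOSE k A (translationMMIS L d) - asymptoticEntropy L d k|
      ≤ (k + 4 : ℝ) * (L : ℝ) ^ (2 * k) * overlapScale L d A.card := by
  have hd1 : 1 ≤ d := by omega
  have hdR : (1 : ℝ) < d := by exact_mod_cast hd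
  have hd0 : (0 : ℝ) < d := by linarith
  have hkR : (2 : ℝ) ≤ k := by exact_mod_cast hk
  have hL1 : (1 : ℝ) ≤ L := by exact_mod_cast NeZero.one_le
  obtain ⟨hG1, hG2⟩ := trace_block_sum_bounds (L := L) hd1 A
  obtain ⟨hQ1, hQ2⟩ := trace_block_sum_pow_bounds (L := L) hd1 hk hA hL
  obtain ⟨hD1, hD2⟩ := sum_crossingWeight_bounds (L := L) hd hk hA hL
  rw [renyiOSE_translationMMIS k hd1 A, asymptoticEntropy]
  set W := ∑ n, translationBlock d A n
  set D := ∑ n, crossingWeight d k A n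
  set x : ℝ := ((d : ℝ) ^ (2 * (k - 1)))⁻¹ with hx
  set X : ℝ := (1 + x) / (1 - x) with hX
  set Q := ((W * W.transpose) ^ k).trace / ((d : ℝ) ^ L) ^ k with hQ
  set G := (W * W.transpose).trace / (L * (d : ℝ) ^ L) with hG
  have hx0 : 0 < x := by positivity
  have hx1 : x < 1 := inv_lt_one_of_one_lt₀ (one_lt_pow₀ hdR (by omega))
  have hX1 : 1 ≤ X := by
    rw [hX, one_le_div (by linarith)]
    linarith
  have hQ1' : 1 ≤ Q := hD1.trans hQ1
  have hratio : ((W * W.transpose) ^ k).trace / (W * W.transpose).trace ^ k = Q / (G * L) ^ k := by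
    have hT : (W * W.transpose).trace = G * (L * (d : ℝ) ^ L) := by
      rw [hG, div_mul_cancel₀ _ (by positivity)]
    rw [hT, hQ, div_div, ← mul_pow]
    congr 2
    ring
  have hlog : Real.log (((W * W.transpose) ^ k).trace / (W * W.transpose).trace ^ k)
      = Real.log Q - k * (Real.log G + Real.log L) := by
    rw [hratio, Real.log_div (by positivity) (by positivity), Real.log_pow,
      Real.log_mul (by positivity) (by positivity)]
  have hdiff : 1 / (1 - (k : ℝ)) *
      Real.log (((W * W.transpose) ^ k).trace / (W * W.transpose).trace ^ k)
        - ((k : ℝ) / ((k : ℝ) - 1) * Real.log L - 1 / ((k : ℝ) - 1) * Real.log X)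
      = 1 / ((k : ℝ) - 1) * ((Real.log X - Real.log Q) + k * Real.log G) := by
    rw [hlog]
    have h1 : (k : ℝ) - 1 ≠ 0 := by linarith
    have h2 : 1 - (k : ℝ) ≠ 0 := by linarith
    field_simp
    ring
  rw [hdiff, abs_mul, abs_of_nonneg (by apply one_div_nonneg.2; linarith)]
  have hlogG : Real.log G ≤ L * (d : ℝ) ^ (-((L : ℝ) / 2)) :=
    (Real.log_le_sub_one_of_pos (by linarith)).trans (by linarith)
  have hlogG0 : 0 ≤ Real.log G := Real.log_nonneg hG1
  have hk1 : 1 / ((k : ℝ) - 1) ≤ 1 := by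
    rw [div_le_one (by linarith)]
    linarith
  have hLp : (L : ℝ) ≤ (L : ℝ) ^ (2 * k) := le_self_pow₀ hL1 (by omega)
  have hxa : x ^ A.card ≤ (d : ℝ) ^ (-(2 * (A.card : ℝ))) := by
    rw [Real.rpow_neg hd0.le, show (2 : ℝ) * A.card = ((2 * A.card : ℕ) : ℝ) by push_cast; rfl,
      Real.rpow_natCast, hx, inv_pow, ← pow_mul]
    apply inv_anti₀ (by positivity)
    apply pow_le_pow_right₀ hdR.le
    apply Nat.mul_le_mul_right
    omega
  have hε : overlapScale L d A.card
      = (d : ℝ) ^ (-(2 * (A.card : ℝ))) + (d : ℝ) ^ (-((L : ℝ) / 2)) := rfl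
  have p1 : 0 < (d : ℝ) ^ (-(2 * (A.card : ℝ))) := Real.rpow_pos_of_pos hd0 _
  have p2 : 0 < (d : ℝ) ^ (-((L : ℝ) / 2)) := Real.rpow_pos_of_pos hd0 _
  set ε := overlapScale L d A.card
  have hε0 : 0 < ε := by rw [hε]; positivity
  have b1 : |Real.log X - Real.log Q| ≤ 3 * (L : ℝ) ^ (2 * k) * ε + (L : ℝ) ^ (2 * k) * ε := by
    have hXD : |D - X| ≤ 3 * (L : ℝ) ^ (2 * k) * ε :=
      hD2.trans (mul_le_mul (by linarith) (by linarith) (by positivity) (by positivity))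
    refine (abs_log_sub_log_le hX1 hQ1').trans ?_
    rw [abs_le] at hXD ⊢
    have : 0 ≤ (L : ℝ) ^ (2 * k) * ε := by positivity
    constructor <;> linarith [hXD.1, hXD.2]
  have b2 : k * Real.log G ≤ k * ((L : ℝ) ^ (2 * k) * ε) := by
    refine mul_le_mul_of_nonneg_left (hlogG.trans ?_) (by linarith)
    exact mul_le_mul hLp (by linarith) p2.le (by positivity)
  calc 1 / ((k : ℝ) - 1) * |Real.log X - Real.log Q + k * Real.log G|
      ≤ 1 * (|Real.log X - Real.log Q| + |k * Real.log G|) :=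
        mul_le_mul hk1 (abs_add_le _ _) (abs_nonneg _) zero_le_one
    _ ≤ (k + 4 : ℝ) * (L : ℝ) ^ (2 * k) * ε := by
        rw [abs_of_nonneg (mul_nonneg (by linarith) hlogG0)]
        linarith

theorem pow_mul_overlapScale_le {k : ℕ} (hd : 2 ≤ d) {c : ℝ} (hc : c < 1) {a : ℕ}
    (hL : 2 * a ≤ L) (ha : 2 * k / ((1 - c) * Real.log d) * Real.log L ≤ a) :
    (L : ℝ) ^ (2 * k) * overlapScale L d a ≤ 2 * (d : ℝ) ^ (-(c * (a : ℝ))) := by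
  have hdR : (1 : ℝ) < d := by exact_mod_cast hd
  have hd0 : (0 : ℝ) < d := by linarith
  have hL0 : (0 : ℝ) < L := by exact_mod_cast NeZero.pos L
  have hlog : 0 < Real.log d := Real.log_pos hdR
  have hLR : (2 : ℝ) * a ≤ L := by exact_mod_cast hL
  have ha0 : (0 : ℝ) ≤ a := Nat.cast_nonneg a
  have h1 : overlapScale L d a ≤ 2 * (d : ℝ) ^ (-(a : ℝ)) := by
    have e1 : (d : ℝ) ^ (-(2 * (a : ℝ))) ≤ (d : ℝ) ^ (-(a : ℝ)) :=
      Real.rpow_le_rpow_of_exponent_le hdR.le (by linarith)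
    have e2 : (d : ℝ) ^ (-((L : ℝ) / 2)) ≤ (d : ℝ) ^ (-(a : ℝ)) :=
      Real.rpow_le_rpow_of_exponent_le hdR.le (by linarith)
    rw [overlapScale]
    linarith
  -- The lower bound on `a` is exactly this inequality after taking logarithms: a fraction `1 - c`
  -- of the decay absorbs the polynomial factor.
  have h2 : (L : ℝ) ^ (2 * k) ≤ (d : ℝ) ^ ((1 - c) * (a : ℝ)) := by
    rw [← Real.log_le_log_iff (by positivity) (Real.rpow_pos_of_pos hd0 _), Real.log_pow,
      Real.log_rpow hd0]
    rw [div_mul_eq_mul_div, div_le_iff₀ (mul_pos (by linarith) hlog)] at ha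
    push_cast
    linarith
  calc (L : ℝ) ^ (2 * k) * overlapScale L d a
      ≤ (d : ℝ) ^ ((1 - c) * (a : ℝ)) * (2 * (d : ℝ) ^ (-(a : ℝ))) := by
        refine mul_le_mul h2 h1 ?_ (Real.rpow_pos_of_pos hd0 _).le
        rw [overlapScale]
        positivity
    _ = 2 * (d : ℝ) ^ (-(c * (a : ℝ))) := by
        rw [mul_left_comm, ← Real.rpow_add hd0]
        congr 2
        ring

end Entropy

theorem mainTheorem9 (d k : ℕ) (hd : 2 ≤ d) (hk : 2 ≤ k) :
    (∃ C : ℝ, ∀ (L : ℕ) [NeZero L] (A : Finset (ZMod L)),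
      IsRingInterval A → 2 * A.card ≤ L →
      |renyiOSE k A (translationMMIS L d) -
          ((k : ℝ) / ((k : ℝ) - 1) * Real.log L -
            1 / ((k : ℝ) - 1) *
              Real.log ((1 + ((d : ℝ) ^ (2 * (k - 1)))⁻¹) / (1 - ((d : ℝ) ^ (2 * (k - 1)))⁻¹)))|
        ≤ C * (L : ℝ) ^ (2 * k) *
            ((d : ℝ) ^ (-(2 * (A.card : ℝ))) + (d : ℝ) ^ (-((L : ℝ) / 2)))) ∧
    (∀ c : ℝ, c < 1 → ∃ K C : ℝ, ∀ (L : ℕ) [NeZero L] (A : Finset (ZMod L)),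
      IsRingInterval A → K * Real.log L ≤ (A.card : ℝ) → 2 * A.card ≤ L →
      |renyiOSE k A (translationMMIS L d) -
          ((k : ℝ) / ((k : ℝ) - 1) * Real.log L -
            1 / ((k : ℝ) - 1) *
              Real.log ((1 + ((d : ℝ) ^ (2 * (k - 1)))⁻¹) / (1 - ((d : ℝ) ^ (2 * (k - 1)))⁻¹)))|
        ≤ C * (d : ℝ) ^ (-(c * (A.card : ℝ)))) := by
  refine ⟨⟨k + 4, fun L _ A hA hL => abs_renyiOSE_sub_le hd hk hA hL⟩, fun c hc =>
    ⟨2 * k / ((1 - c) * Real.log d), (k + 4) * 2, fun L _ A hA hK hL => ?_⟩⟩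
  refine (abs_renyiOSE_sub_le hd hk hA hL).trans ?_
  rw [mul_assoc, mul_assoc]
  exact mul_le_mul_of_nonneg_left (pow_mul_overlapScale_le hd hc hL hK) (by positivity)
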